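/- All graphs are finite and simple. For graphs $G,H$ and an integer $q\ge 1$ write $G\to_{\mathrm{ind}}(H)_q$ if for every colouring of the edges of $G$ with $q$ colours there is a set $S$ of vertices of $G$ such that the induced subgraph $G[S]$ is isomorphic to $H$ and all edges of $G[S]$ have the same colour. Let $r_{\mathrm{ind}}(H;q)$ and $\hat r_{\mathrm{ind}}(H;q)$ be the minimum number of vertices, respectively of edges, of a graph $G$ with $G\to_{\mathrm{ind}}(H)_q$. A graph $H$ is a $w$-blowup of a graph $T$ if there is a graph homomorphism $\phi\colon H\to T$ (edges go to edges) with $|\phi^{-1}(v)|\le w$ for every vertex $v$ of $T$. **Theorem 1.3.** There is an absolute constant $C$ such that the following holds for every $q\ge 1$ and every tree $T$ with $n$ vertices and maximum degree $k$ (with the convention $0^0=1$ when $n=1$). 1. $r_{\mathrm{ind}}(T;q)\le (kq)^{Cq^4k^3}\,n$ and $\hat r_{\mathrm{ind}}(T;q)\le (kq)^{Cq^4k^3}\,n$. 2. $r_{\mathrm{ind}}(T;q)\le \hat r_{\mathrm{ind}}(T;q)+1$; and if $q\ge 2$ and $T$ is not a star (that is, $k\le n-2$), then $r_{\mathrm{ind}}(T;q)\le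 \hat r_{\mathrm{ind}}(T;q)$. 3. If $(k,q)\ne(1,1)$ and $H$ is a $w$-blowup of $T$, then $\hat r_{\mathrm{ind}}(H;q)\le (kq)^{Cq^4k^3w}\,n$. -/

import Mathlib

namespace IndRamsey

/-- The induced arrow `G →_ind (H)_q`: every colouring of the edges of `G` with `q` colours admits a
copy of `H` which is an induced subgraph of `G` (a graph embedding of `H` into `G`) and all of whose
edges have the same colour `c`. -/
def Arrows {V W : Type*} (G : SimpleGraph V) (H : SimpleGraph W) (q : ℕ) : Prop :=
  ∀ χ : G.EdgeLabeling (Fin q), ∃ (f : H ↪g G) (c : Fin q),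
    ∀ (u v : W) (h : H.Adj u v), χ.get (f u) (f v) (f.map_adj_iff.mpr h) = c

/-- The induced `q`-colour Ramsey number `r_ind(H; q)`: the least number of vertices of a finite
graph `G` with `G →_ind (H)_q`. It takes values in `ℕ∞`, the value `⊤` meaning that there is no such
`G`; so an upper bound by a natural number includes the existence of a suitable `G`. -/
noncomputable def ramsey {W : Type*} (H : SimpleGraph W) (q : ℕ) : ℕ∞ :=
  ⨅ (N : ℕ) (G : SimpleGraph (Fin N)) (_ : Arrows G H q), (N : ℕ∞)

/-- The induced `q`-colour size-Ramsey number: the least number of edges of a finite graph `G` with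
`G →_ind (H)_q` (and `⊤` if there is no such `G`). -/
noncomputable def sizeRamsey {W : Type*} (H : SimpleGraph W) (q : ℕ) : ℕ∞ :=
  ⨅ (N : ℕ) (G : SimpleGraph (Fin N)) (_ : Arrows G H q), G.edgeSet.encard

/-- `G'` is an `s`-blowup of `G`: there is a graph homomorphism `G' → G` all of whose fibres have at
most `s` elements. -/
def IsBlowup {V' V : Type*} (s : ℕ) (G' : SimpleGraph V') (G : SimpleGraph V) : Prop :=
  ∃ φ : G' →g G, ∀ v : V, (φ ⁻¹' {v}).encard ≤ s

end IndRamsey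

/-!
The vertex numbers are compared with the edge numbers directly. If `G` arrows the tree `T`, then so
does one of its connected components (`Arrows.exists_component`), and a connected graph has at most
one vertex more than edges, with equality only for trees. A tree arrows no connected graph without
a dominating vertex, because colouring its edges by the parity of their depth leaves only
monochromatic stars (`not_arrows_of_isTree`).

For the upper bounds it suffices to bound the edge number for a `w`-blowup `H` of `T`. The host is
a sparse base graph whose vertices are replaced by blobs of `2 ^ r` vertices and whose edges are
replaced by copies of the Hadamard graph (`hostGraph`). The base graph is bipartite, of order linear
in `n` and typical degree `O(q * k)`, and it is locally sparse: a small set and a set `k + 1` times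
as large never span many edges (`exists_locally_sparse`, by counting).

Given a colouring of the host, dependent random choice turns the blobs on the left side into subsets
`A x` and chooses a colour for every edge of the base graph, such that any `w`
vertices from each of the sets `A x` around a right vertex `y` have many common neighbours in the blob of `y`,
adjacency being in the chosen colours (`exists_rich_step`). This property survives further shrinking, so the
right vertices can be treated one after the other, and each `A x` shrinks only once for every
neighbour of `x`, by a factor depending on `k`, `q`, `w` alone (`exists_rich`). Since the Hadamard
graph is quasirandom, randomly chosen vertices of the sets `A x` are then, around most `y`, flexible: every
prescription of neighbours (in the right colours) and non-neighbours among them is realized by many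
vertices of the blob of `y` (`exists_mostly_flexible`).

What remains is a colouring of most edges of the base graph. In a most popular colour there is a
part of large minimum degree, which expands by local sparsity and so contains a copy of `T` by the
theorem of Friedman and Pippenger (`exists_tree_embedding`, `exists_tree_in_dense_part`). The copy
need not be induced: flexibility allows for choosing the vertices of `H` in the blobs along it with
exactly the prescribed adjacencies (`exists_embedding_of_flexible`).
-/

namespace IndRamsey

/-! ### Components, and edge colourings of trees by depth -/

section Components

open SimpleGraph

theorem Arrows.mono_host {V V' W : Type*} {G : SimpleGraph V} {G' : SimpleGraph V'}
    {H : SimpleGraph W} {q : ℕ} (e : G ↪g G') (h : Arrows G H q) : Arrows G' H q := by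
  intro χ
  obtain ⟨f, c, hf⟩ := h (χ.pullback e.toHom)
  refine ⟨e.comp f, c, fun u v huv => ?_⟩
  exact hf u v huv

theorem ramsey_le_card {V W : Type*} [Fintype V] {G : SimpleGraph V} {H : SimpleGraph W} {q : ℕ}
    (h : Arrows G H q) : ramsey H q ≤ Fintype.card V := by
  classical
  let e := Fintype.equivFin V
  refine iInf_le_of_le (Fintype.card V) (iInf_le_of_le (G.comap e.symm) (iInf_le_of_le ?_ le_rfl))
  exact h.mono_host (Iso.comap e.symm G).symm.toEmbedding

theorem sizeRamsey_le_encard {V W : Type*} [Fintype V] {G : SimpleGraph V} {H : SimpleGraph W}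
    {q : ℕ} (h : Arrows G H q) : sizeRamsey H q ≤ G.edgeSet.encard := by
  classical
  let e := Fintype.equivFin V
  let i := (Iso.comap e.symm G)
  refine iInf_le_of_le (Fintype.card V) (iInf_le_of_le (G.comap e.symm) (iInf_le_of_le ?_ ?_))
  · exact h.mono_host i.symm.toEmbedding
  · exact (i.mapEdgeSet.toEmbedding).encard_le

/-- If no component of `G` arrowed `T`, bad colourings of the components would together form a bad
colouring of `G`, because a copy of a connected graph lies in a single component. -/
theorem Arrows.exists_component {V W : Type*} {G : SimpleGraph V} {T : SimpleGraph W} {q : ℕ}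
    (hT : T.Connected) (h : Arrows G T q) :
    ∃ c : G.ConnectedComponent, Arrows (G.induce c.supp) T q := by
  classical
  by_contra hcon
  push Not at hcon
  unfold Arrows at hcon
  push Not at hcon
  choose χ hχ using hcon
  let lab : ∀ x y : V, G.Adj x y → Fin q := fun x y hxy =>
    (χ (G.connectedComponentMk x)).get ⟨x, rfl⟩
      ⟨y, (ConnectedComponent.connectedComponentMk_eq_of_adj hxy).symm⟩ hxy
  have lab_eq : ∀ (c : G.ConnectedComponent) (x y : V) (hxy : G.Adj x y) (hx : x ∈ c.supp)
      (hy : y ∈ c.supp), lab x y hxy = (χ c).get ⟨x, hx⟩ ⟨y, hy⟩ hxy := by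
    intro c x y hxy hx hy
    obtain rfl := hx
    rfl
  let L : G.EdgeLabeling (Fin q) := EdgeLabeling.mk lab (by
    intro x y hxy
    have hx : x ∈ (G.connectedComponentMk x).supp := rfl
    have hy : y ∈ (G.connectedComponentMk x).supp :=
      (ConnectedComponent.connectedComponentMk_eq_of_adj hxy).symm
    rw [lab_eq (G.connectedComponentMk x) x y hxy hx hy,
      lab_eq (G.connectedComponentMk x) y x hxy.symm hy hx]
    exact (χ (G.connectedComponentMk x)).get_comm _ _ _)
  obtain ⟨f, c, hf⟩ := h L
  obtain ⟨w₀⟩ := hT.nonempty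
  let C := G.connectedComponentMk (f w₀)
  have hmem : ∀ w, f w ∈ C.supp := by
    intro w
    exact ConnectedComponent.sound ((hT.preconnected w w₀).map f.toHom)
  let g : T ↪g G.induce C.supp :=
    ⟨⟨fun w => ⟨f w, hmem w⟩, fun a b hab => f.injective (by simpa using hab)⟩, f.map_adj_iff⟩
  obtain ⟨u, v, huv, hne⟩ := hχ C g c
  apply hne
  rw [← hf u v huv]
  exact (lab_eq C _ _ (f.map_adj_iff.mpr huv) (hmem u) (hmem v)).symm

/-- In a tree with root `r`, two neighbours of `u` that are closer to `r` than `u` coincide. -/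
theorem eq_of_adj_of_dist_succ {V : Type*} {G : SimpleGraph V} (hG : G.IsTree) (r : V)
    {u v w : V} (hv : G.Adj v u) (hw : G.Adj w u) (hdv : G.dist r u = G.dist r v + 1)
    (hdw : G.dist r u = G.dist r w + 1) : v = w := by
  classical
  have key : ∀ x, G.Adj x u → G.dist r u = G.dist r x + 1 →
      ∃ p : G.Walk r x, p.IsPath ∧ u ∉ p.support := by
    intro x hx hdx
    obtain ⟨p, hp, hlen⟩ := (hG.connected.preconnected r x).exists_path_of_dist
    refine ⟨p, hp, fun hu => ?_⟩
    have h1 := p.length_takeUntil_le_length hu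
    have h2 := dist_le (p.takeUntil u hu)
    omega
  obtain ⟨p, hp, hpu⟩ := key v hv hdv
  obtain ⟨p', hp', hpu'⟩ := key w hw hdw
  have h1 : (p.concat hv).IsPath := hp.concat hpu hv
  have h2 : (p'.concat hw).IsPath := hp'.concat hpu' hw
  have h3 : p.concat hv = p'.concat hw :=
    congrArg Subtype.val ((hG.isAcyclic.subsingleton_path r u).elim ⟨_, h1⟩ ⟨_, h2⟩)
  simpa using congrArg Walk.penultimate h3

/-- A tree does not arrow a connected graph that has no dominating vertex: the colouring of the
edges by the parity of their depth has only stars as monochromatic components. -/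
theorem not_arrows_of_isTree {V W : Type*} {G : SimpleGraph V} (hG : G.IsTree)
    {T : SimpleGraph W} (hT : T.Connected) {q : ℕ} (hq : 2 ≤ q)
    (hdom : ∀ v : W, ∃ u, u ≠ v ∧ ¬ T.Adj v u) : ¬ Arrows G T q := by
  classical
  intro h
  obtain ⟨r⟩ := hG.connected.nonempty
  let lab : ∀ x y : V, G.Adj x y → Fin q := fun x y _ =>
    ⟨min (G.dist r x) (G.dist r y) % 2, by omega⟩
  obtain ⟨f, c, hf⟩ := h (EdgeLabeling.mk lab (by intro x y _; simp [lab, min_comm]))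
  have hf' : ∀ u v, T.Adj u v → min (G.dist r (f u)) (G.dist r (f v)) % 2 = c := by
    intro u v huv
    exact congrArg Fin.val (hf u v huv)
  have hstep : ∀ u v, T.Adj u v → G.dist r (f u) = G.dist r (f v) + 1 ∨
      G.dist r (f v) = G.dist r (f u) + 1 := by
    intro u v huv
    exact hG.dist_eq_dist_add_one_of_adj r (f.map_adj_iff.mpr huv)
  have := hT.nonempty
  obtain ⟨v₀, hv₀⟩ : ∃ v₀, ∀ v, G.dist r (f v₀) ≤ G.dist r (f v) :=
    ⟨_, fun v => Function.argmin_le (fun v => G.dist r (f v)) v⟩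
  have hclosed : ∀ u w, T.Adj u w → (u = v₀ ∨ T.Adj v₀ u) → (w = v₀ ∨ T.Adj v₀ w) := by
    rintro u w huw (rfl | hu)
    · exact Or.inr huw
    · left
      have a1 := hstep _ _ hu
      have a2 := hstep _ _ huw
      have a3 := hv₀ u
      have a4 := hv₀ w
      have a5 := hf' _ _ hu
      have a6 := hf' _ _ huw
      have hdu : G.dist r (f u) = G.dist r (f v₀) + 1 := by omega
      have hdw : G.dist r (f u) = G.dist r (f w) + 1 := by
        rcases a2 with a2 | a2
        · exact a2
        · rw [min_eq_left (by omega)] at a5 a6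
          omega
      exact f.injective (eq_of_adj_of_dist_succ hG r (f.map_adj_iff.mpr huw.symm)
        (f.map_adj_iff.mpr hu) hdw hdu)
  have hall : ∀ w, w = v₀ ∨ T.Adj v₀ w := by
    intro w
    obtain ⟨p⟩ := hT.preconnected v₀ w
    have : ∀ {a b : W} (p : T.Walk a b), (a = v₀ ∨ T.Adj v₀ a) → (b = v₀ ∨ T.Adj v₀ b) := by
      intro a b p
      induction p with
      | nil => exact id
      | cons hadj _ ih => exact fun ha => ih (hclosed _ _ hadj ha)
    exact this p (Or.inl rfl)
  obtain ⟨u, hu, hnu⟩ := hdom v₀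
  rcases hall u with h | h
  · exact hu h
  · exact hnu h

/-- A component of `G` that arrows `T` has at most one vertex more than `G` has edges, and equality
would make it a tree. -/
theorem Arrows.ramsey_le_encard_edgeSet {V W : Type*} [Fintype V] {G : SimpleGraph V}
    {T : SimpleGraph W} {q : ℕ} (hT : T.Connected) (h : Arrows G T q) :
    ramsey T q ≤ G.edgeSet.encard + 1 ∧
      (2 ≤ q → (∀ v : W, ∃ u, u ≠ v ∧ ¬ T.Adj v u) → ramsey T q ≤ G.edgeSet.encard) := by
  classical
  obtain ⟨c, hc⟩ := h.exists_component hT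
  have hconn : (G.induce c.supp).Connected := c.connected_toSimpleGraph
  have hle := hconn.card_vert_le_card_edgeSet_add_one
  have hram := ramsey_le_card hc
  rw [← Nat.card_eq_fintype_card] at hram
  have hcard : ((Nat.card (G.induce c.supp).edgeSet : ℕ) : ℕ∞) ≤ G.edgeSet.encard := by
    rw [← ENat.card_eq_coe_natCard]
    exact (Embedding.mapEdgeSet (Embedding.induce c.supp)).encard_le
  refine ⟨hram.trans (le_trans ?_ (add_le_add_left hcard 1)), fun hq hdom => ?_⟩
  · exact_mod_cast hle
  · refine hram.trans (le_trans ?_ hcard)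
    have hne : Nat.card (G.induce c.supp).edgeSet + 1 ≠ Nat.card c.supp := fun heq =>
      not_arrows_of_isTree (isTree_iff_connected_and_card.mpr ⟨hconn, heq⟩) hT hq hdom hc
    exact_mod_cast (by omega : Nat.card c.supp ≤ Nat.card (G.induce c.supp).edgeSet)

theorem ramsey_le_sizeRamsey_add_one {W : Type*} {T : SimpleGraph W} (hT : T.Connected) (q : ℕ) :
    ramsey T q ≤ sizeRamsey T q + 1 := by
  rw [sizeRamsey, ← tsub_le_iff_right]
  refine le_iInf fun N => le_iInf fun G => le_iInf fun h => ?_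
  exact tsub_le_iff_right.mpr (h.ramsey_le_encard_edgeSet hT).1

theorem ramsey_le_sizeRamsey {W : Type*} {T : SimpleGraph W} (hT : T.Connected) {q : ℕ}
    (hq : 2 ≤ q) (hdom : ∀ v : W, ∃ u, u ≠ v ∧ ¬ T.Adj v u) : ramsey T q ≤ sizeRamsey T q :=
  le_iInf fun _ => le_iInf fun _ => le_iInf fun h => (h.ramsey_le_encard_edgeSet hT).2 hq hdom

theorem exists_not_adj_of_maxDegree {V : Type*} [Fintype V] (T : SimpleGraph V)
    [DecidableRel T.Adj] (h : T.maxDegree + 2 ≤ Fintype.card V) (v : V) :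
    ∃ u, u ≠ v ∧ ¬ T.Adj v u := by
  classical
  by_contra hcon
  push Not at hcon
  have h1 : Finset.univ.erase v ⊆ T.neighborFinset v := fun u hu => by
    simpa using hcon u (by simpa using hu)
  have h2 := Finset.card_le_card h1
  rw [Finset.card_erase_of_mem (Finset.mem_univ v), card_neighborFinset_eq_degree,
    Finset.card_univ] at h2
  have := T.degree_le_maxDegree v
  omega

end Components

open Finset

/-! ### The Friedman–Pippenger theorem -/

section TreeEmbedding

variable {V : Type*} [DecidableEq V]

/-- The Friedman–Pippenger invariant: `S` is the set of vertices already used, `B x` is the number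
of further neighbours that `x` may still ask for, and every set of at most `m` vertices of `U` has
enough unused neighbours to serve all its requests. -/
def Serves (nbr : V → Finset V) (U : Finset V) (m : ℕ) (S : Finset V) (B : V → ℕ) : Prop :=
  ∀ X ⊆ U, #X ≤ m → ∑ x ∈ X, B x ≤ #(X.biUnion nbr \ S)

/-- A request can always be served. If no unused neighbour `y` of `v` were admissible, each of them
would lie in the neighbourhood of a critical set avoiding `v`, that is, one serving its requests
with equality. Unions of critical sets are critical, by submodularity and because expansion keeps
critical sets small, so some critical set would contain all unused neighbours of `v` in its
neighbourhood; adding `v` to it violates the invariant. -/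
theorem Serves.extend {nbr : V → Finset V} {U : Finset V} {k m : ℕ}
    (hexp : ∀ X ⊆ U, #X ≤ 2 * m → (k + 1) * #X ≤ #(X.biUnion nbr))
    {S : Finset V} {B : V → ℕ} (hB : ∀ x, B x ≤ k) (hS : #S < m) (h : Serves nbr U m S B)
    {v : V} (hv : v ∈ U) (hBv : 1 ≤ B v) :
    ∃ y ∈ nbr v \ S, Serves nbr U m (insert y S) (Function.update B v (B v - 1)) := by
  by_contra hcon
  push Not at hcon
  have hsum : ∀ X, v ∉ X → ∑ x ∈ X, Function.update B v (B v - 1) x = ∑ x ∈ X, B x := by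
    intro X hX
    refine sum_congr rfl fun x hx => ?_
    rw [Function.update_of_ne (by rintro rfl; exact hX hx)]
  have hsum' : ∀ X, v ∈ X → ∑ x ∈ X, Function.update B v (B v - 1) x + 1 = ∑ x ∈ X, B x := by
    intro X hX
    rw [← add_sum_erase X _ hX, ← add_sum_erase X B hX, Function.update_self,
      hsum _ (notMem_erase v X)]
    omega
  let Crit : Finset V → Prop := fun X =>
    X ⊆ U ∧ #X ≤ m ∧ v ∉ X ∧ #(X.biUnion nbr \ S) = ∑ x ∈ X, B x
  have hsmall : ∀ X ⊆ U, #X ≤ 2 * m → #(X.biUnion nbr \ S) ≤ ∑ x ∈ X, B x → #X ≤ #S := by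
    intro X hXU hX hle
    have h1 := hexp X hXU hX
    have h2 : #(X.biUnion nbr) ≤ #(X.biUnion nbr \ S) + #S := by
      have := le_card_sdiff S (X.biUnion nbr)
      omega
    have h3 : ∑ x ∈ X, B x ≤ #X * k := sum_le_card_nsmul _ _ _ fun x _ => hB x
    nlinarith
  have hunion : ∀ X Y, Crit X → Crit Y → Crit (X ∪ Y) := by
    rintro X Y ⟨hXU, hXm, hXv, hX⟩ ⟨hYU, hYm, hYv, hY⟩
    have hle : #((X ∪ Y).biUnion nbr \ S) ≤ ∑ x ∈ X ∪ Y, B x := by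
      have h1 : (X ∪ Y).biUnion nbr \ S = (X.biUnion nbr \ S) ∪ (Y.biUnion nbr \ S) := by
        rw [union_biUnion, union_sdiff_distrib]
      have h2 : (X ∩ Y).biUnion nbr \ S ⊆ (X.biUnion nbr \ S) ∩ (Y.biUnion nbr \ S) := by
        intro z hz
        simp only [mem_sdiff, mem_biUnion, mem_inter] at hz ⊢
        obtain ⟨⟨a, ⟨ha, hb⟩, haz⟩, hzS⟩ := hz
        exact ⟨⟨⟨a, ha, haz⟩, hzS⟩, ⟨a, hb, haz⟩, hzS⟩
      have h3 := card_union_add_card_inter (X.biUnion nbr \ S) (Y.biUnion nbr \ S)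
      have h4 := card_le_card h2
      have h5 := h (X ∩ Y) (inter_subset_left.trans hXU)
        ((card_le_card inter_subset_left).trans hXm)
      have h6 := sum_union_inter (s₁ := X) (s₂ := Y) (f := B)
      rw [h1]
      omega
    have hU : X ∪ Y ⊆ U := union_subset hXU hYU
    have hm : #(X ∪ Y) ≤ m :=
      (hsmall _ hU ((card_union_le X Y).trans (by omega)) hle).trans hS.le
    exact ⟨hU, hm, by simp [hXv, hYv], le_antisymm hle (h _ hU hm)⟩
  have hcrit : ∀ y ∈ nbr v \ S, ∃ X, Crit X ∧ y ∈ X.biUnion nbr := by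
    intro y hy
    have hbad := hcon y hy
    unfold Serves at hbad
    push Not at hbad
    obtain ⟨X, hXU, hXm, hlt⟩ := hbad
    have hX := h X hXU hXm
    have hyS := (mem_sdiff.mp hy).2
    have h1 : X.biUnion nbr \ insert y S = (X.biUnion nbr \ S).erase y := by
      ext z
      simp only [mem_sdiff, mem_insert, mem_erase]
      tauto
    rw [h1] at hlt
    have hpred := pred_card_le_card_erase (s := X.biUnion nbr \ S) (a := y)
    by_cases hvX : v ∈ X
    · have := hsum' X hvX
      omega
    · rw [hsum X hvX] at hlt
      by_cases hyX : y ∈ X.biUnion nbr \ S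
      · rw [card_erase_of_mem hyX] at hlt
        exact ⟨X, ⟨hXU, hXm, hvX, by omega⟩, (mem_sdiff.mp hyX).1⟩
      · rw [erase_eq_of_notMem hyX] at hlt
        omega
  have hall : ∀ Y ⊆ nbr v \ S, ∃ X, Crit X ∧ Y ⊆ X.biUnion nbr := by
    intro Y
    induction Y using Finset.induction_on with
    | empty => exact fun _ => ⟨∅, ⟨empty_subset _, by simp, by simp, by simp⟩, empty_subset _⟩
    | insert y Y _ ih =>
      intro hY
      obtain ⟨X, hX, hYX⟩ := ih ((subset_insert y Y).trans hY)
      obtain ⟨X', hX', hyX'⟩ := hcrit y (hY (mem_insert_self y Y))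
      refine ⟨X ∪ X', hunion _ _ hX hX', insert_subset ?_ ?_⟩
      · rw [union_biUnion]
        exact mem_union_right _ hyX'
      · rw [union_biUnion]
        exact hYX.trans subset_union_left
  obtain ⟨X, ⟨hXU, hXm, hvX, hX⟩, hsub⟩ := hall _ Subset.rfl
  have hXS := hsmall X hXU (by omega) hX.le
  have h1 := h (insert v X) (insert_subset hv hXU) (by rw [card_insert_of_notMem hvX]; omega)
  have h2 : (insert v X).biUnion nbr \ S ⊆ X.biUnion nbr \ S := by
    rw [biUnion_insert, union_sdiff_distrib]
    refine union_subset (fun z hz => mem_sdiff.mpr ⟨hsub hz, (mem_sdiff.mp hz).2⟩) Subset.rfl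
  have h3 := card_le_card h2
  rw [sum_insert hvX] at h1
  omega

/-- The Friedman–Pippenger theorem: a symmetric relation on `U` in which sets of at most twice the
order of a tree expand by the factor `k + 1` contains every tree of maximum degree `k`. -/
theorem exists_tree_embedding {W : Type*} [Fintype W] {T : SimpleGraph W} [DecidableRel T.Adj]
    (hT : T.IsTree) {k : ℕ} (hk : T.maxDegree ≤ k) {nbr : V → Finset V} {U : Finset V}
    (hU : U.Nonempty) (hnbr : ∀ x, nbr x ⊆ U) (hsymm : ∀ x y, y ∈ nbr x → x ∈ nbr y)
    (hexp : ∀ X ⊆ U, #X ≤ 2 * Fintype.card W → (k + 1) * #X ≤ #(X.biUnion nbr)) :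
    ∃ ψ : W → V, Function.Injective ψ ∧ ∀ u w, T.Adj u w → ψ w ∈ nbr (ψ u) := by
  classical
  obtain ⟨r⟩ := hT.connected.nonempty
  obtain ⟨u₀, hu₀⟩ := hU
  have hpos : 0 < Fintype.card W := Fintype.card_pos_iff.mpr ⟨r⟩
  let child : W → W → Prop := fun a b => T.Adj a b ∧ T.dist r b = T.dist r a + 1
  -- `A` is the part of the tree embedded so far, closed under passing to parents, and `B (ψ a)` is
  -- `k` minus the number of children of `a` in `A`
  have key : ∀ j, 1 ≤ j → j ≤ Fintype.card W → ∃ (A : Finset W) (ψ : W → V) (B : V → ℕ),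
      #A = j ∧ r ∈ A ∧ (∀ a b, child a b → b ∈ A → a ∈ A) ∧ Set.InjOn ψ A ∧
      (∀ a ∈ A, ψ a ∈ U) ∧ (∀ a ∈ A, ∀ b ∈ A, child a b → ψ b ∈ nbr (ψ a)) ∧
      (∀ x, B x ≤ k) ∧ (∀ x, x ∉ A.image ψ → B x = k) ∧
      (∀ a ∈ A, k ≤ B (ψ a) + #{b ∈ A | child a b}) ∧
      Serves nbr U (Fintype.card W) (A.image ψ) B := by
    intro j hj
    induction j, hj using Nat.le_induction with
    | base =>
      intro _
      refine ⟨{r}, fun _ => u₀, fun _ => k, by simp, by simp, ?_, by simp, by simpa using hu₀, ?_,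
        fun _ => le_rfl, fun _ _ => rfl, by simp, ?_⟩
      · rintro a b ⟨_, hd⟩ hb
        rw [mem_singleton.mp hb, SimpleGraph.dist_self] at hd
        omega
      · rintro a ha b hb ⟨hab, _⟩
        rw [mem_singleton.mp ha, mem_singleton.mp hb] at hab
        exact (T.irrefl hab).elim
      · intro X hXU hX
        rcases X.eq_empty_or_nonempty with rfl | hne
        · simp
        · have h1 := hexp X hXU (by omega)
          have h2 := le_card_sdiff (({r} : Finset W).image (fun _ => u₀)) (X.biUnion nbr)
          have h3 : #(({r} : Finset W).image (fun _ => u₀)) = 1 := by simp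
          have h4 := hne.card_pos
          rw [sum_const, smul_eq_mul]
          rw [h3] at h2
          have h5 : #X * k + #X = (k + 1) * #X := by ring
          omega
    | succ j hj ih =>
      intro hjn
      obtain ⟨A, ψ, B, hA, hrA, hcl, hinj, hψU, hψ, hBk, hBn, hBc, hserve⟩ := ih (by omega)
      -- a vertex outside `A` at minimal depth has its parent in `A`
      obtain ⟨v, hvA, hvmin⟩ : ∃ v, v ∉ A ∧ ∀ w, w ∉ A → T.dist r v ≤ T.dist r w := by
        have hne : ({w | w ∉ A} : Set W).Nonempty := by
          by_contra hemp
          have : A = univ := by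
            ext w
            by_contra hw
            exact hemp ⟨w, by simpa using hw⟩
          rw [this, card_univ] at hA
          omega
        exact ⟨_, Function.argminOn_mem (T.dist r) _ hne,
          fun w hw => Function.argminOn_le (T.dist r) _ hw⟩
      obtain ⟨p, hpv⟩ : ∃ p, child p v := by
        have hrv : r ≠ v := fun h => hvA (h ▸ hrA)
        obtain ⟨w, hw⟩ := hT.connected.exists_walk_length_eq_dist v r
        cases w with
        | nil => exact (hrv rfl).elim
        | @cons _ p _ hvp w' =>
          have h1 := T.dist_le w'
          have h2 := hT.dist_eq_dist_add_one_of_adj r hvp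
          rw [SimpleGraph.Walk.length_cons] at hw
          rw [T.dist_comm] at h1 hw
          exact ⟨p, hvp.symm, by omega⟩
      have hpA : p ∈ A := by
        by_contra hp
        have := hvmin p hp
        have := hpv.2
        omega
      have hBp : 1 ≤ B (ψ p) := by
        have h1 := hBc p hpA
        have h2 : #{b ∈ A | child p b} < T.degree p := by
          rw [← T.card_neighborFinset_eq_degree]
          refine card_lt_card ⟨fun b hb => ?_, fun hsub => ?_⟩
          · simpa using (mem_filter.mp hb).2.1
          · exact hvA (mem_filter.mp (hsub (by simpa using hpv.1))).1
        have h3 := T.degree_le_maxDegree p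
        omega
      have hcardim : #(A.image ψ) = j := by rw [card_image_of_injOn hinj, hA]
      obtain ⟨y, hy, hserve'⟩ := hserve.extend hexp hBk (by omega) (hψU p hpA) hBp
      obtain ⟨hyp, hyA⟩ := mem_sdiff.mp hy
      have hψ' : ∀ a ∈ A, Function.update ψ v y a = ψ a := fun a ha =>
        Function.update_of_ne (by rintro rfl; exact hvA ha) _ _
      have him : (insert v A).image (Function.update ψ v y) = insert y (A.image ψ) := by
        rw [image_insert, Function.update_self]
        congr 1
        exact image_congr fun a ha => hψ' a ha
      have hyne : ∀ a ∈ A, ψ a ≠ y := fun a ha h => hyA (h ▸ mem_image_of_mem ψ ha)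
      refine ⟨insert v A, Function.update ψ v y, Function.update B (ψ p) (B (ψ p) - 1),
        by rw [card_insert_of_notMem hvA, hA], mem_insert_of_mem hrA, ?_, ?_, ?_, ?_, ?_, ?_, ?_,
        by rw [him]; exact hserve'⟩
      · intro a b hab hb
        rcases mem_insert.mp hb with rfl | hb
        · have : a = p := eq_of_adj_of_dist_succ hT r hab.1 hpv.1 hab.2 hpv.2
          exact mem_insert_of_mem (this ▸ hpA)
        · exact mem_insert_of_mem (hcl a b hab hb)
      · rw [coe_insert]
        refine (Set.injOn_insert (by simpa using hvA)).mpr ⟨?_, ?_⟩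
        · exact hinj.congr fun a ha => (hψ' a ha).symm
        · rintro ⟨a, ha, hav⟩
          rw [Function.update_self, hψ' a ha] at hav
          exact hyne a ha hav
      · intro a ha
        rcases mem_insert.mp ha with rfl | ha
        · rw [Function.update_self]
          exact hnbr _ hyp
        · rw [hψ' a ha]
          exact hψU a ha
      · intro a ha b hb hab
        rcases mem_insert.mp hb with rfl | hb
        · have : a = p := eq_of_adj_of_dist_succ hT r hab.1 hpv.1 hab.2 hpv.2
          rw [Function.update_self, this, hψ' p hpA]
          exact hyp
        · rcases mem_insert.mp ha with rfl | ha
          · exact (hvA (hcl _ b hab (by assumption))).elim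
          · rw [hψ' a ha, hψ' b hb]
            exact hψ a ha b hb hab
      · intro x
        rcases eq_or_ne x (ψ p) with rfl | hx
        · rw [Function.update_self]
          have := hBk (ψ p)
          omega
        · rw [Function.update_of_ne hx]
          exact hBk x
      · intro x hx
        rw [him, mem_insert, not_or] at hx
        rw [Function.update_of_ne (by rintro rfl; exact hx.2 (mem_image_of_mem ψ hpA))]
        exact hBn x hx.2
      · intro a ha
        have hmono : #{b ∈ A | child a b} ≤ #{b ∈ insert v A | child a b} :=
          card_le_card (filter_subset_filter _ (subset_insert v A))
        rcases mem_insert.mp ha with rfl | ha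
        · rw [Function.update_self, Function.update_of_ne (hyne p hpA).symm, hBn y hyA]
          omega
        · rw [hψ' a ha]
          rcases eq_or_ne a p with rfl | hap
          · rw [Function.update_self, filter_insert, if_pos hpv,
              card_insert_of_notMem (fun h => hvA (mem_filter.mp h).1)]
            have := hBc a ha
            omega
          · rw [Function.update_of_ne (fun h => hap (hinj ha hpA h))]
            have := hBc a ha
            omega
  obtain ⟨A, ψ, B, hA, -, -, hinj, -, hψ, -⟩ := key _ hpos le_rfl
  obtain rfl : A = univ := (card_eq_iff_eq_univ A).mp hA
  refine ⟨ψ, fun a b hab => hinj (by simp) (by simp) hab, fun u w huw => ?_⟩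
  rcases hT.dist_eq_dist_add_one_of_adj r huw with h | h
  · exact hsymm _ _ (hψ w (mem_univ _) u (mem_univ _) ⟨huw.symm, h⟩)
  · exact hψ u (mem_univ _) w (mem_univ _) ⟨huw, h⟩

end TreeEmbedding

/-! ### Locally sparse bipartite graphs -/

section RandomHost

theorem pow_self_le_three_pow_mul_factorial (b : ℕ) : (b : ℝ) ^ b ≤ 3 ^ b * b.factorial := by
  have h1 := Real.pow_div_factorial_le_exp (b : ℝ) (by positivity) b
  have h2 : Real.exp b ≤ 3 ^ b := by
    rw [← Real.exp_one_pow]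
    exact pow_le_pow_left₀ (Real.exp_pos 1).le Real.exp_one_lt_three.le b
  exact (div_le_iff₀ (by positivity)).mp (h1.trans h2)

theorem choose_mul_pow_le (n b : ℕ) : (n.choose b : ℝ) * b ^ b ≤ (3 * n) ^ b := by
  have h1 : (n.choose b : ℝ) * b.factorial ≤ n ^ b := by
    have := Nat.choose_le_pow_div (α := ℝ) b n
    rwa [le_div_iff₀ (by positivity)] at this
  calc (n.choose b : ℝ) * b ^ b ≤ n.choose b * (3 ^ b * b.factorial) := by
        gcongr
        exact pow_self_le_three_pow_mul_factorial b
    _ = 3 ^ b * (n.choose b * b.factorial) := by ring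
    _ ≤ 3 ^ b * n ^ b := by gcongr
    _ = (3 * n) ^ b := by rw [mul_pow]

theorem choose_le_div_pow {n b : ℕ} (hb : 0 < b) : (n.choose b : ℝ) ≤ (3 * n / b) ^ b := by
  rw [div_pow, le_div_iff₀ (by positivity)]
  exact choose_mul_pow_le n b

theorem card_filter_le_card_preimage {α β : Type*} [Fintype α] [DecidableEq α] [Fintype β]
    [DecidableEq β] [Nonempty β] (P : Finset α) (Y : Finset β) (t : ℕ) :
    (#{f : α → β | t ≤ #{p ∈ P | f p ∈ Y}} : ℝ) ≤
      (#P).choose t * (#Y / Fintype.card β) ^ t * Fintype.card β ^ Fintype.card α := by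
  have hsub : ({f : α → β | t ≤ #{p ∈ P | f p ∈ Y}} : Finset (α → β)) ⊆
      (P.powersetCard t).biUnion fun E => Fintype.piFinset fun p => if p ∈ E then Y else univ := by
    intro f hf
    obtain ⟨E, hE, hEt⟩ := exists_subset_card_eq (mem_filter.mp hf).2
    refine mem_biUnion.mpr ⟨E, mem_powersetCard.mpr ⟨hE.trans (filter_subset _ _), hEt⟩, ?_⟩
    refine Fintype.mem_piFinset.mpr fun p => ?_
    split_ifs with hp
    · exact (mem_filter.mp (hE hp)).2
    · exact mem_univ _
  have hcard : ∀ E ∈ P.powersetCard t,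
      (#(Fintype.piFinset fun p => if p ∈ E then Y else univ) : ℝ) =
        (#Y / Fintype.card β) ^ t * Fintype.card β ^ Fintype.card α := by
    intro E hE
    have hEt := (mem_powersetCard.mp hE).2
    have hβ : (Fintype.card β : ℝ) ≠ 0 := by exact_mod_cast Fintype.card_ne_zero
    have h1 : ∀ p, (#(if p ∈ E then Y else univ) : ℝ) =
        (if p ∈ E then (#Y / Fintype.card β : ℝ) else 1) * Fintype.card β := by
      intro p
      split_ifs
      · field_simp
      · simp
    rw [Fintype.card_piFinset, Nat.cast_prod, prod_congr rfl fun p _ => h1 p, prod_mul_distrib,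
      prod_const, card_univ, prod_ite_mem, univ_inter, prod_const, hEt]
  calc (#{f : α → β | t ≤ #{p ∈ P | f p ∈ Y}} : ℝ)
      ≤ ∑ E ∈ P.powersetCard t, (#(Fintype.piFinset fun p => if p ∈ E then Y else univ) : ℝ) := by
        exact_mod_cast (card_le_card hsub).trans card_biUnion_le
    _ = (#P).choose t * (#Y / Fintype.card β) ^ t * Fintype.card β ^ Fintype.card α := by
        rw [sum_congr rfl hcard, sum_const, card_powersetCard, nsmul_eq_mul, mul_assoc]

/-- The union bound behind the local sparsity of the random host, for sets of orders `a` and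
`K * a` and `2 * (K + 1) * a` pairs between them. -/
theorem choose_mul_choose_le {N K q n a p y : ℕ} (hN : N = 27648 * q ^ 2 * K ^ 2 * n)
    (hK : 1 ≤ K) (hq : 1 ≤ q) (ha : 1 ≤ a) (han : a ≤ 2 * n)
    (hpy : p * y = K * a * (a * (16 * q * (K + 1)))) :
    (N.choose a : ℝ) * N.choose (K * a) *
      (p.choose (2 * (K + 1) * a) * (y / N) ^ (2 * (K + 1) * a)) ≤ (1 / 8) ^ a := by
  have hKr : (1 : ℝ) ≤ K := by exact_mod_cast hK
  have hqr : (1 : ℝ) ≤ q := by exact_mod_cast hq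
  have har : (1 : ℝ) ≤ a := by exact_mod_cast ha
  have hanr : (a : ℝ) ≤ 2 * n := by exact_mod_cast han
  have hnr : (0 : ℝ) < n := by linarith
  have hN : (N : ℝ) = 27648 * q ^ 2 * K ^ 2 * n := by exact_mod_cast hN
  have hNpos : (0 : ℝ) < N := by rw [hN]; positivity
  have hpyr : (p : ℝ) * y = K * a * (a * (16 * q * (K + 1))) := by exact_mod_cast hpy
  set v : ℝ := N / a with hv
  have hvpos : 0 < v := by positivity
  have hvlow : 13824 * q ^ 2 * K ^ 2 ≤ v := by
    rw [hv, le_div_iff₀ (by positivity), hN]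
    have : (13824 * q ^ 2 * K ^ 2 : ℝ) * a ≤ 13824 * q ^ 2 * K ^ 2 * (2 * n) := by gcongr
    linarith
  have h1 : (N.choose a : ℝ) ≤ (3 * v) ^ a := by
    refine (choose_le_div_pow (by omega)).trans_eq ?_
    rw [hv]; ring
  have h2 : (N.choose (K * a) : ℝ) ≤ (3 * v) ^ (K * a) := by
    refine (choose_le_div_pow (by positivity)).trans ?_
    refine pow_le_pow_left₀ (by positivity) ?_ _
    rw [hv, mul_div_assoc]
    gcongr
    nlinarith
  have h3 : (p.choose (2 * (K + 1) * a) : ℝ) * (y / N) ^ (2 * (K + 1) * a) ≤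
      (24 * q * K / v) ^ (2 * (K + 1) * a) := by
    calc (p.choose (2 * (K + 1) * a) : ℝ) * (y / N) ^ (2 * (K + 1) * a)
        ≤ (3 * p / (2 * (K + 1) * a : ℕ)) ^ (2 * (K + 1) * a) * (y / N) ^ (2 * (K + 1) * a) := by
          gcongr
          exact choose_le_div_pow (by positivity)
      _ = (24 * q * K / v) ^ (2 * (K + 1) * a) := by
          rw [← mul_pow]
          congr 1
          rw [hv]
          push_cast
          field_simp
          linear_combination 3 * hpyr
  calc (N.choose a : ℝ) * N.choose (K * a) *
      (p.choose (2 * (K + 1) * a) * (y / N) ^ (2 * (K + 1) * a))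
      ≤ (3 * v) ^ a * (3 * v) ^ (K * a) * (24 * q * K / v) ^ (2 * (K + 1) * a) := by gcongr
    _ = (3 * v * (24 * q * K / v) ^ 2) ^ ((K + 1) * a) := by
        rw [mul_pow (3 * v), ← pow_mul, ← pow_add]
        congr 2 <;> ring
    _ ≤ (1 / 8) ^ ((K + 1) * a) := by
        refine pow_le_pow_left₀ (by positivity) ?_ _
        have : 3 * v * (24 * q * K / v) ^ 2 = 1728 * q ^ 2 * K ^ 2 / v := by
          field_simp
          ring
        rw [this, div_le_iff₀ hvpos]
        linarith
    _ ≤ (1 / 8) ^ a := pow_le_pow_of_le_one (by norm_num) (by norm_num) (by nlinarith)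

/-- Existence of a locally sparse bipartite multigraph: `f (x, i)` is the `i`-th neighbour of the
left vertex `x`. Between a small set and a set `K` times as large there are few pairs, and few
pairs end in a small proportion of the right vertices. A uniformly random `f` does it. -/
theorem exists_locally_sparse {N d K q n : ℕ} (hN : N = 27648 * q ^ 2 * K ^ 2 * n)
    (hd : d = 16 * q * (K + 1)) (hK : 1 ≤ K) (hq : 1 ≤ q) (hn : 1 ≤ n) :
    ∃ f : Fin N × Fin d → Fin N,
      (∀ X Y : Finset (Fin N), 1 ≤ #X → #X ≤ 2 * n → #Y = K * #X →
        #{p ∈ X ×ˢ univ | f p ∈ Y} < 2 * (K + 1) * #X) ∧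
      (∀ X Y : Finset (Fin N), 1 ≤ #Y → #Y ≤ 2 * n → #X = K * #Y →
        #{p ∈ X ×ˢ univ | f p ∈ Y} < 2 * (K + 1) * #Y) ∧
      (∀ Y : Finset (Fin N), 64 * #Y ≤ N → 2 * #{p | f p ∈ Y} < N * d) := by
  have hNpos : 1 ≤ N := by
    have : 0 < N := by rw [hN]; positivity
    omega
  have : NeZero N := ⟨by omega⟩
  let Bad : Finset (Fin N × Fin d) → Finset (Fin N) → ℕ → Finset (Fin N × Fin d → Fin N) :=
    fun P Y t => {f | t ≤ #{p ∈ P | f p ∈ Y}}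
  let tot : ℝ := (N : ℝ) ^ Fintype.card (Fin N × Fin d)
  have htot : 0 < tot := by
    have : (0 : ℝ) < N := by exact_mod_cast hNpos
    positivity
  have hBad : ∀ P Y t, (#(Bad P Y t) : ℝ) ≤ (#P).choose t * (#Y / N) ^ t * tot := by
    intro P Y t
    simpa only [Fintype.card_fin] using card_filter_le_card_preimage P Y t
  -- the three kinds of failure, for sets of order `a` on the left, on the right, and for large sets
  let E₁ : ℕ → Finset (Fin N × Fin d → Fin N) := fun a =>
    (powersetCard a univ).biUnion fun X => (powersetCard (K * a) univ).biUnion fun Y =>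
      Bad (X ×ˢ univ) Y (2 * (K + 1) * a)
  let E₂ : ℕ → Finset (Fin N × Fin d → Fin N) := fun a =>
    (powersetCard a univ).biUnion fun Y => (powersetCard (K * a) univ).biUnion fun X =>
      Bad (X ×ˢ univ) Y (2 * (K + 1) * a)
  let E₃ : Finset (Fin N × Fin d → Fin N) :=
    ({Y | 64 * #Y ≤ N} : Finset (Finset (Fin N))).biUnion fun Y =>
      Bad univ Y (N * (8 * q * (K + 1)))
  have hE₁ : ∀ a ∈ Icc 1 (2 * n), (#(E₁ a) : ℝ) ≤ (1 / 8) ^ a * tot := by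
    intro a ha
    obtain ⟨ha1, ha2⟩ := mem_Icc.mp ha
    calc (#(E₁ a) : ℝ) ≤ ∑ X ∈ powersetCard a (univ : Finset (Fin N)),
          ∑ Y ∈ powersetCard (K * a) (univ : Finset (Fin N)),
            (#(Bad (X ×ˢ univ) Y (2 * (K + 1) * a)) : ℝ) := by
          exact_mod_cast card_biUnion_le.trans (sum_le_sum fun X _ => card_biUnion_le)
      _ ≤ ∑ X ∈ powersetCard a (univ : Finset (Fin N)),
          ∑ Y ∈ powersetCard (K * a) (univ : Finset (Fin N)),
            (((a * d).choose (2 * (K + 1) * a) : ℝ) *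
              ((K * a : ℕ) / N) ^ (2 * (K + 1) * a)) * tot := by
          refine sum_le_sum fun X hX => sum_le_sum fun Y hY => ?_
          refine (hBad _ _ _).trans_eq ?_
          rw [card_product, (mem_powersetCard.mp hX).2, (mem_powersetCard.mp hY).2, card_univ,
            Fintype.card_fin]
      _ = (N.choose a : ℝ) * N.choose (K * a) * ((a * d).choose (2 * (K + 1) * a) *
            ((K * a : ℕ) / N) ^ (2 * (K + 1) * a)) * tot := by
          simp only [sum_const, card_powersetCard, card_univ, Fintype.card_fin, nsmul_eq_mul]
          ring
      _ ≤ (1 / 8) ^ a * tot := by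
          gcongr
          exact choose_mul_choose_le hN hK hq ha1 ha2 (by rw [hd]; ring)
  have hE₂ : ∀ a ∈ Icc 1 (2 * n), (#(E₂ a) : ℝ) ≤ (1 / 8) ^ a * tot := by
    intro a ha
    obtain ⟨ha1, ha2⟩ := mem_Icc.mp ha
    calc (#(E₂ a) : ℝ) ≤ ∑ Y ∈ powersetCard a (univ : Finset (Fin N)),
          ∑ X ∈ powersetCard (K * a) (univ : Finset (Fin N)),
            (#(Bad (X ×ˢ univ) Y (2 * (K + 1) * a)) : ℝ) := by
          exact_mod_cast card_biUnion_le.trans (sum_le_sum fun X _ => card_biUnion_le)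
      _ ≤ ∑ Y ∈ powersetCard a (univ : Finset (Fin N)),
          ∑ X ∈ powersetCard (K * a) (univ : Finset (Fin N)),
            (((K * a * d).choose (2 * (K + 1) * a) : ℝ) *
              (a / N) ^ (2 * (K + 1) * a)) * tot := by
          refine sum_le_sum fun X hX => sum_le_sum fun Y hY => ?_
          refine (hBad _ _ _).trans_eq ?_
          rw [card_product, (mem_powersetCard.mp hX).2, (mem_powersetCard.mp hY).2, card_univ,
            Fintype.card_fin]
      _ = (N.choose a : ℝ) * N.choose (K * a) * ((K * a * d).choose (2 * (K + 1) * a) *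
            (a / N) ^ (2 * (K + 1) * a)) * tot := by
          simp only [sum_const, card_powersetCard, card_univ, Fintype.card_fin, nsmul_eq_mul]
          ring
      _ ≤ (1 / 8) ^ a * tot := by
          gcongr
          exact choose_mul_choose_le hN hK hq ha1 ha2 (by rw [hd]; ring)
  have hE₃ : (#E₃ : ℝ) ≤ 1 / 8 * tot := by
    set u := N * (8 * q * (K + 1)) with hu
    have huN : N ≤ u := Nat.le_mul_of_pos_right _ (by positivity)
    have hNr : (0 : ℝ) < N := by exact_mod_cast hNpos
    calc (#E₃ : ℝ) ≤ ∑ Y ∈ ({Y | 64 * #Y ≤ N} : Finset (Finset (Fin N))),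
          (#(Bad univ Y u) : ℝ) := by exact_mod_cast card_biUnion_le
      _ ≤ ∑ Y ∈ ({Y | 64 * #Y ≤ N} : Finset (Finset (Fin N))), 2 ^ (2 * u) * (1 / 64) ^ u * tot := by
          refine sum_le_sum fun Y hY => (hBad _ _ _).trans ?_
          have hY' : (64 * #Y : ℝ) ≤ N := by exact_mod_cast (mem_filter.mp hY).2
          have hY'' : (#Y / N : ℝ) ≤ 1 / 64 := by
            rw [div_le_div_iff₀ hNr (by norm_num)]
            linarith
          gcongr
          · have h1 : #(univ : Finset (Fin N × Fin d)) = 2 * u := by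
              simp only [card_univ, Fintype.card_prod, Fintype.card_fin, hd, hu]
              ring
            rw [h1]
            exact_mod_cast Nat.choose_le_two_pow (2 * u) u
      _ ≤ 2 ^ N * (2 ^ (2 * u) * (1 / 64) ^ u * tot) := by
          rw [sum_const, nsmul_eq_mul]
          gcongr
          have := card_filter_le (univ : Finset (Finset (Fin N))) (fun Y => 64 * #Y ≤ N)
          rw [card_univ, Fintype.card_finset, Fintype.card_fin] at this
          exact_mod_cast this
      _ ≤ 2 ^ u * (2 ^ (2 * u) * (1 / 64) ^ u * tot) := by
          gcongr
          norm_num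
      _ = (1 / 8) ^ u * tot := by
          have : (1 / 64 : ℝ) ^ u = (1 / 8) ^ u * (1 / 8) ^ u := by
            rw [← mul_pow]; norm_num
          have h8 : (2 : ℝ) ^ u * 2 ^ (2 * u) * (1 / 8) ^ u = 1 := by
            rw [pow_mul 2 2 u, ← mul_pow, ← mul_pow]; norm_num
          rw [this]
          linear_combination ((1 / 8) ^ u * tot) * h8
      _ ≤ 1 / 8 * tot := by
          gcongr
          exact pow_le_of_le_one (by norm_num) (by norm_num) (by omega)
  have hgeom : ∑ a ∈ Icc 1 (2 * n), (1 / 8 : ℝ) ^ a ≤ 1 / 7 := by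
    have h1 : ∀ m, ∑ a ∈ Icc 1 m, (1 / 8 : ℝ) ^ a = 1 / 7 * (1 - (1 / 8) ^ m) := by
      intro m
      induction m with
      | zero => simp
      | succ m ih =>
        rw [sum_Icc_succ_top (by omega), ih]
        ring
    rw [h1]
    have : (0 : ℝ) < (1 / 8) ^ (2 * n) := by positivity
    linarith
  have hcover : (#((Icc 1 (2 * n)).biUnion E₁ ∪ (Icc 1 (2 * n)).biUnion E₂ ∪ E₃) : ℝ) < tot := by
    have h1 : (#((Icc 1 (2 * n)).biUnion E₁) : ℝ) ≤ 1 / 7 * tot := by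
      calc (#((Icc 1 (2 * n)).biUnion E₁) : ℝ) ≤ ∑ a ∈ Icc 1 (2 * n), (#(E₁ a) : ℝ) := by
            exact_mod_cast card_biUnion_le
        _ ≤ ∑ a ∈ Icc 1 (2 * n), (1 / 8) ^ a * tot := sum_le_sum hE₁
        _ ≤ 1 / 7 * tot := by rw [← sum_mul]; gcongr
    have h2 : (#((Icc 1 (2 * n)).biUnion E₂) : ℝ) ≤ 1 / 7 * tot := by
      calc (#((Icc 1 (2 * n)).biUnion E₂) : ℝ) ≤ ∑ a ∈ Icc 1 (2 * n), (#(E₂ a) : ℝ) := by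
            exact_mod_cast card_biUnion_le
        _ ≤ ∑ a ∈ Icc 1 (2 * n), (1 / 8) ^ a * tot := sum_le_sum hE₂
        _ ≤ 1 / 7 * tot := by rw [← sum_mul]; gcongr
    have h3 : (#((Icc 1 (2 * n)).biUnion E₁ ∪ (Icc 1 (2 * n)).biUnion E₂ ∪ E₃) : ℝ) ≤
        #((Icc 1 (2 * n)).biUnion E₁) + #((Icc 1 (2 * n)).biUnion E₂) + #E₃ := by
      exact_mod_cast (card_union_le _ _).trans (add_le_add_left (card_union_le _ _) _)
    linarith
  obtain ⟨f, hf⟩ : ∃ f, f ∉ (Icc 1 (2 * n)).biUnion E₁ ∪ (Icc 1 (2 * n)).biUnion E₂ ∪ E₃ := by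
    by_contra hall
    push Not at hall
    rw [eq_univ_of_forall hall, card_univ, Fintype.card_fun, Fintype.card_fin] at hcover
    simp [tot] at hcover
  simp only [mem_union, not_or] at hf
  obtain ⟨⟨hf1, hf2⟩, hf3⟩ := hf
  refine ⟨f, fun X Y hX hX' hY => ?_, fun X Y hY hY' hX => ?_, fun Y hY => ?_⟩
  · by_contra hlt
    refine hf1 (mem_biUnion.mpr ⟨#X, mem_Icc.mpr ⟨hX, hX'⟩, mem_biUnion.mpr ⟨X, ?_,
      mem_biUnion.mpr ⟨Y, ?_, ?_⟩⟩⟩)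
    · simp
    · simp [hY]
    · exact mem_filter.mpr ⟨mem_univ _, not_lt.mp hlt⟩
  · by_contra hlt
    refine hf2 (mem_biUnion.mpr ⟨#Y, mem_Icc.mpr ⟨hY, hY'⟩, mem_biUnion.mpr ⟨Y, ?_,
      mem_biUnion.mpr ⟨X, ?_, ?_⟩⟩⟩)
    · simp
    · simp [hX]
    · exact mem_filter.mpr ⟨mem_univ _, not_lt.mp hlt⟩
  · by_contra hlt
    refine hf3 (mem_biUnion.mpr ⟨Y, by simpa using hY, mem_filter.mpr ⟨mem_univ _, ?_⟩⟩)
    have : N * d = 2 * (N * (8 * q * (K + 1))) := by rw [hd]; ring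
    omega

end RandomHost

/-! ### Quasirandomness of the Hadamard graph -/

section Hadamard

variable {r : ℕ}

/-- The Hadamard (inner product) graph on the vectors of `𝔽₂ ^ r`, written as subsets of `Fin r`:
`i` and `j` are related when their inner product is `1`. -/
def Hadamard (i j : Finset (Fin r)) : Prop := Odd #(i ∩ j)

instance (i j : Finset (Fin r)) : Decidable (Hadamard i j) :=
  inferInstanceAs (Decidable (Odd _))

theorem Hadamard.symm_iff {i j : Finset (Fin r)} : Hadamard i j ↔ Hadamard j i := by
  rw [Hadamard, Hadamard, inter_comm]

theorem neg_one_pow_card_inter (i j : Finset (Fin r)) :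
    (-1 : ℤ) ^ #(i ∩ j) = ∏ a ∈ i, if a ∈ j then -1 else 1 := by
  rw [prod_ite, prod_const, prod_const_one, mul_one, filter_mem_eq_inter]

/-- The characters of `𝔽₂ ^ r` are orthogonal. -/
theorem sum_neg_one_pow_mul (j j' : Finset (Fin r)) :
    ∑ i : Finset (Fin r), (-1 : ℤ) ^ #(i ∩ j) * (-1) ^ #(i ∩ j') =
      if j = j' then 2 ^ r else 0 := by
  simp only [neg_one_pow_card_inter, ← prod_mul_distrib]
  rw [← powerset_univ, ← prod_one_add]
  split_ifs with h
  · subst h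
    rw [prod_congr rfl (g := fun _ => (2 : ℤ))]
    · simp
    · intro a _
      split_ifs <;> norm_num
  · obtain ⟨a, ha⟩ : ∃ a, ¬ (a ∈ j ↔ a ∈ j') := by
      by_contra hcon
      push Not at hcon
      exact h (Finset.ext hcon)
    refine prod_eq_zero (mem_univ a) ?_
    by_cases h1 : a ∈ j <;> by_cases h2 : a ∈ j' <;> simp_all

theorem sum_sq_sum_neg_one_pow (S : Finset (Finset (Fin r))) :
    ∑ i : Finset (Fin r), (∑ j ∈ S, (-1 : ℤ) ^ #(i ∩ j)) ^ 2 = 2 ^ r * #S := by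
  simp only [sq, sum_mul_sum]
  rw [sum_comm]
  have h : ∀ j ∈ S, ∑ i : Finset (Fin r), ∑ j' ∈ S, (-1 : ℤ) ^ #(i ∩ j) * (-1) ^ #(i ∩ j') =
      2 ^ r := by
    intro j hj
    rw [sum_comm]
    simp only [sum_neg_one_pow_mul, sum_ite_eq, if_pos hj]
  rw [sum_congr rfl h, sum_const, nsmul_eq_mul, mul_comm]

theorem sum_neg_one_pow_eq (S : Finset (Finset (Fin r))) (i : Finset (Fin r)) :
    ∑ j ∈ S, (-1 : ℤ) ^ #(i ∩ j) = #{j ∈ S | ¬ Hadamard i j} - #{j ∈ S | Hadamard i j} := by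
  have h : ∀ j ∈ S, (-1 : ℤ) ^ #(i ∩ j) = if Hadamard i j then -1 else 1 := by
    intro j _
    split_ifs with hij
    · exact hij.neg_one_pow
    · exact (Nat.not_odd_iff_even.mp hij).neg_one_pow
  rw [sum_congr rfl h, sum_ite, sum_const, sum_const]
  simp only [smul_neg, nsmul_eq_mul, mul_one]
  ring

/-- Lindsey's lemma in the form of a variance bound: few vertices see a proportion of `S` that
differs much from one half. -/
theorem card_deviating_mul_card_le (S D : Finset (Finset (Fin r)))
    (hD : ∀ i ∈ D, 3 * #{j ∈ S | Hadamard i j} < #S ∨ 3 * #{j ∈ S | ¬ Hadamard i j} < #S) :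
    #D * #S ≤ 9 * 2 ^ r := by
  rcases S.eq_empty_or_nonempty with rfl | hS
  · simp
  have h1 : ∀ i ∈ D, (#S : ℤ) ^ 2 ≤ 9 * (∑ j ∈ S, (-1 : ℤ) ^ #(i ∩ j)) ^ 2 := by
    intro i hi
    rw [sum_neg_one_pow_eq]
    have h2 := card_filter_add_card_filter_not (s := S) (fun j => Hadamard i j)
    have h3 : (#{j ∈ S | ¬ Hadamard i j} : ℤ) = #S - #{j ∈ S | Hadamard i j} := by
      rw [← h2]; push_cast; ring
    rcases hD i hi with h | h
    · have h4 : (3 * #{j ∈ S | Hadamard i j} : ℤ) < #S := by exact_mod_cast h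
      rw [h3]
      nlinarith
    · have h4 : (3 * #{j ∈ S | ¬ Hadamard i j} : ℤ) < #S := by exact_mod_cast h
      rw [h3] at h4 ⊢
      nlinarith
  have h2 : (#D : ℤ) * #S ^ 2 ≤ 9 * (2 ^ r * #S) := by
    calc (#D : ℤ) * #S ^ 2 = ∑ i ∈ D, (#S : ℤ) ^ 2 := by rw [sum_const, nsmul_eq_mul]
      _ ≤ ∑ i ∈ D, 9 * (∑ j ∈ S, (-1 : ℤ) ^ #(i ∩ j)) ^ 2 := sum_le_sum h1
      _ ≤ ∑ i, 9 * (∑ j ∈ S, (-1 : ℤ) ^ #(i ∩ j)) ^ 2 :=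
        sum_le_sum_of_subset_of_nonneg (subset_univ D) fun _ _ _ => by positivity
      _ = 9 * (2 ^ r * #S) := by rw [← mul_sum, sum_sq_sum_neg_one_pow]
  have h3 : #D * #S * #S ≤ 9 * 2 ^ r * #S := by
    have : (#D : ℤ) * #S * #S ≤ 9 * 2 ^ r * #S := by linarith
    exact_mod_cast this
  exact Nat.le_of_mul_le_mul_right h3 hS.card_pos

end Hadamard

/-! ### Dependent random choice -/

section DependentRandomChoice

/-- Dependent random choice towards several sets at once. If every `j ∈ J` is related to a
proportion `1 / m` of each `A x`, then the common neighbourhoods `A' x ⊆ A x` of a suitable sample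
of `t` elements of `J` are not much smaller than `A x`, while every choice of `w` elements from each
`A' x` has more than `z` common neighbours. Convexity bounds the average of `∏ x, #(A' x)` from
below; a choice with few common neighbours rarely survives the sampling. -/
theorem exists_rich_subsets {ι B : Type*} [Fintype ι] [DecidableEq ι] [Fintype B] [DecidableEq B]
    (A : ι → Finset B) (J : Finset B) (E : ι → B → B → Prop) [∀ x i j, Decidable (E x i j)]
    {m t w z : ℕ} (ht : t ≠ 0) (hA : ∀ x, (A x).Nonempty)
    (hE : ∀ x, ∀ j ∈ J, #(A x) ≤ m * #{i ∈ A x | E x i j})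
    (hbig : 2 * Fintype.card B ^ (w * Fintype.card ι) * z ^ t * m ^ (Fintype.card ι * t) <
      #J ^ t) :
    ∃ A' : ι → Finset B, (∀ x, A' x ⊆ A x) ∧
      (∀ x, #(A x) ≤ 2 * m ^ (Fintype.card ι * t) * #(A' x)) ∧
      ∀ S : ι → Fin w → B, (∀ x l, S x l ∈ A' x) → z < #{j | ∀ x l, E x (S x l) j} := by
  by_contra hcon
  push Not at hcon
  let Aτ : (Fin t → B) → ι → Finset B := fun τ x => {i ∈ A x | ∀ s, E x i (τ s)}
  let P : Finset (ι → B) := Fintype.piFinset A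
  let Ω : Finset (Fin t → B) := Fintype.piFinset fun _ => J
  have hPpos : 0 < #P := by
    rw [Fintype.card_piFinset]
    exact prod_pos fun x _ => (hA x).card_pos
  have hP : #P = ∏ x, #(A x) := Fintype.card_piFinset A
  let deg : (ι → B) → ℕ := fun p => #{j ∈ J | ∀ x, E x (p x) j}
  have hdeg : ∑ p ∈ P, deg p = ∑ j ∈ J, ∏ x, #{i ∈ A x | E x i j} := by
    simp only [deg, card_filter]
    rw [sum_comm]
    refine sum_congr rfl fun j _ => ?_
    rw [← card_filter]
    simp only [← card_filter]
    rw [← Fintype.card_piFinset]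
    congr 1
    ext p
    simp only [P, mem_filter, Fintype.mem_piFinset]
    exact ⟨fun h x => ⟨h.1 x, h.2 x⟩, fun h => ⟨fun x => (h x).1, fun x => (h x).2⟩⟩
  -- the average number of elements of `J` related to all coordinates of a point of the product, and
  -- then its `t`-th moment, which counts the points surviving the sampling
  have hlow : #J * #P ≤ m ^ Fintype.card ι * ∑ p ∈ P, deg p := by
    rw [hdeg, mul_sum, ← smul_eq_mul, ← sum_const]
    refine sum_le_sum fun j hj => ?_
    rw [hP, ← card_univ, ← prod_const, ← prod_mul_distrib]
    exact prod_le_prod' fun x _ => hE x j hj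
  have hconv : (∑ p ∈ P, deg p) ^ t * #P ≤ #P ^ t * ∑ p ∈ P, deg p ^ t := by
    obtain ⟨t, rfl⟩ := Nat.exists_eq_succ_of_ne_zero ht
    have h1 := pow_sum_div_card_le_sum_pow (s := P) (f := fun p => (deg p : ℝ))
      (fun _ _ => by positivity) t
    have hPr : (0 : ℝ) < #P := by exact_mod_cast hPpos
    rw [div_le_iff₀ (by positivity)] at h1
    have h2 : (∑ p ∈ P, (deg p : ℝ)) ^ (t + 1) * #P ≤ #P ^ (t + 1) * ∑ p ∈ P, (deg p : ℝ) ^ (t + 1) := by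
      calc (∑ p ∈ P, (deg p : ℝ)) ^ (t + 1) * #P
          ≤ (∑ p ∈ P, (deg p : ℝ) ^ (t + 1)) * #P ^ t * #P := by gcongr
        _ = #P ^ (t + 1) * ∑ p ∈ P, (deg p : ℝ) ^ (t + 1) := by ring
    exact_mod_cast h2
  have hswap : ∑ τ ∈ Ω, ∏ x, #(Aτ τ x) = ∑ p ∈ P, deg p ^ t := by
    have h1 : ∀ τ, ∏ x, #(Aτ τ x) = #{p ∈ P | ∀ x s, E x (p x) (τ s)} := by
      intro τ
      rw [← Fintype.card_piFinset]
      congr 1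
      ext p
      simp only [P, Aτ, mem_filter, Fintype.mem_piFinset]
      exact ⟨fun h => ⟨fun x => (h x).1, fun x => (h x).2⟩, fun h x => ⟨h.1 x, h.2 x⟩⟩
    have h2 : ∀ p, deg p ^ t = #{τ ∈ Ω | ∀ x s, E x (p x) (τ s)} := by
      intro p
      have : ({τ ∈ Ω | ∀ x s, E x (p x) (τ s)} : Finset (Fin t → B)) =
          Fintype.piFinset fun _ => {j ∈ J | ∀ x, E x (p x) j} := by
        ext τ
        simp only [Ω, mem_filter, Fintype.mem_piFinset]
        exact ⟨fun h s => ⟨h.1 s, fun x => h.2 x s⟩, fun h => ⟨fun s => (h s).1, fun x s => (h s).2 x⟩⟩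
      rw [this, Fintype.card_piFinset, prod_const, card_univ, Fintype.card_fin]
    simp only [h1, h2, card_filter]
    exact sum_comm
  have hmain : #J ^ t * #P ≤ m ^ (Fintype.card ι * t) * ∑ τ ∈ Ω, ∏ x, #(Aτ τ x) := by
    rw [hswap]
    refine Nat.le_of_mul_le_mul_left ?_ (pow_pos hPpos t)
    calc #P ^ t * (#J ^ t * #P) = (#J * #P) ^ t * #P := by rw [mul_pow]; ring
      _ ≤ (m ^ Fintype.card ι * ∑ p ∈ P, deg p) ^ t * #P := by gcongr
      _ = m ^ (Fintype.card ι * t) * ((∑ p ∈ P, deg p) ^ t * #P) := by rw [mul_pow, pow_mul]; ring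
      _ ≤ m ^ (Fintype.card ι * t) * (#P ^ t * ∑ p ∈ P, deg p ^ t) := by gcongr
      _ = #P ^ t * (m ^ (Fintype.card ι * t) * ∑ p ∈ P, deg p ^ t) := by ring
  -- the samples that leave a choice with at most `z` common neighbours
  let Poor : Finset (ι → Fin w → B) := {S | #{j | ∀ x l, E x (S x l) j} ≤ z}
  let Fail : Finset (Fin t → B) :=
    Poor.biUnion fun S => Fintype.piFinset fun _ => {j | ∀ x l, E x (S x l) j}
  have hFail : #Fail ≤ Fintype.card B ^ (w * Fintype.card ι) * z ^ t := by
    refine (card_biUnion_le_card_mul _ _ (z ^ t) fun S hS => ?_).trans ?_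
    · rw [Fintype.card_piFinset, prod_const, card_univ, Fintype.card_fin]
      exact Nat.pow_le_pow_left (mem_filter.mp hS).2 t
    · refine Nat.mul_le_mul_right _ ((card_le_univ _).trans_eq ?_)
      rw [Fintype.card_fun, Fintype.card_fun, Fintype.card_fin, pow_mul]
  have hle : ∀ τ, ∏ x, #(Aτ τ x) ≤ #P := by
    intro τ
    rw [hP]
    exact prod_le_prod' fun x _ => card_le_card (filter_subset _ _)
  have hterm : ∀ τ ∈ Ω, 2 * m ^ (Fintype.card ι * t) * ∏ x, #(Aτ τ x) ≤
      #P + if τ ∈ Fail then 2 * m ^ (Fintype.card ι * t) * #P else 0 := by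
    intro τ _
    split_ifs with hτ
    · exact (Nat.mul_le_mul_left _ (hle τ)).trans (Nat.le_add_left _ _)
    · by_cases hx : ∀ x, #(A x) ≤ 2 * m ^ (Fintype.card ι * t) * #(Aτ τ x)
      · obtain ⟨S, hS, hSz⟩ := hcon (Aτ τ) (fun x => filter_subset _ _) hx
        refine (hτ (mem_biUnion.mpr ⟨S, mem_filter.mpr ⟨mem_univ _, hSz⟩, ?_⟩)).elim
        refine Fintype.mem_piFinset.mpr fun s => mem_filter.mpr ⟨mem_univ _, fun x l => ?_⟩
        exact (mem_filter.mp (hS x l)).2 s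
      · push Not at hx
        obtain ⟨x, hx⟩ := hx
        rw [add_zero, hP, ← mul_prod_erase univ _ (mem_univ x),
          ← mul_prod_erase univ (fun x => #(A x)) (mem_univ x), ← mul_assoc]
        exact Nat.mul_le_mul hx.le (prod_le_prod' fun y _ => card_le_card (filter_subset _ _))
  have hΩ : #Ω = #J ^ t := by
    rw [Fintype.card_piFinset, prod_const, card_univ, Fintype.card_fin]
  have hsum : 2 * m ^ (Fintype.card ι * t) * ∑ τ ∈ Ω, ∏ x, #(Aτ τ x) ≤
      #J ^ t * #P + #Fail * (2 * m ^ (Fintype.card ι * t) * #P) := by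
    rw [mul_sum]
    refine (sum_le_sum hterm).trans ?_
    rw [sum_add_distrib, sum_const, smul_eq_mul, hΩ, ← sum_filter, sum_const, smul_eq_mul]
    gcongr
    exact fun τ hτ => (mem_filter.mp hτ).2
  have hfin : #J ^ t * #P ≤
      (2 * Fintype.card B ^ (w * Fintype.card ι) * z ^ t * m ^ (Fintype.card ι * t)) * #P := by
    have h1 : #Fail * (2 * m ^ (Fintype.card ι * t) * #P) ≤
        Fintype.card B ^ (w * Fintype.card ι) * z ^ t * (2 * m ^ (Fintype.card ι * t) * #P) := by
      gcongr
    have h2 : (2 * Fintype.card B ^ (w * Fintype.card ι) * z ^ t * m ^ (Fintype.card ι * t)) * #P =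
      Fintype.card B ^ (w * Fintype.card ι) * z ^ t * (2 * m ^ (Fintype.card ι * t) * #P) := by ring
    rw [h2]
    have h3 : 2 * m ^ (Fintype.card ι * t) * ∑ τ ∈ Ω, ∏ x, #(Aτ τ x) =
      2 * (m ^ (Fintype.card ι * t) * ∑ τ ∈ Ω, ∏ x, #(Aτ τ x)) := by ring
    omega
  exact absurd (Nat.le_of_mul_le_mul_right hfin hPpos) (not_le.mpr hbig)

end DependentRandomChoice

/-! ### Rich families of subsets of the blobs -/

section Cleaning

variable {L R : Type*} [Fintype L] [DecidableEq L] [DecidableEq R] {r q : ℕ}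

/-- The family `A` is rich towards a blob coloured by `col` with respect to the left vertices `X`
and the colours `c`: any `w` elements from each `A x`, `x ∈ X`, have more than `z` common neighbours
in the blob, where adjacency to the elements of `A x` is required to be in colour `c x`. -/
def Rich (w z : ℕ) (X : Finset L) (col : L → Finset (Fin r) → Finset (Fin r) → Fin q)
    (c : L → Fin q) (A : L → Finset (Finset (Fin r))) : Prop :=
  ∀ S : L → Fin w → Finset (Fin r), (∀ x ∈ X, ∀ l, S x l ∈ A x) →
    z < #{j | ∀ x ∈ X, ∀ l, Hadamard (S x l) j ∧ col x (S x l) j = c x}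

theorem Rich.mono {w z : ℕ} {X : Finset L}
    {col : L → Finset (Fin r) → Finset (Fin r) → Fin q} {c : L → Fin q}
    {A A' : L → Finset (Finset (Fin r))} (h : Rich w z X col c A) (hA : ∀ x, A' x ⊆ A x) :
    Rich w z X col c A' :=
  fun S hS => h S fun x hx l => hA x (hS x hx l)

/-- Making one right vertex rich. Most elements `j` of its blob see a third of every `A x`, hence a
proportion `1 / (3 * q)` of it in some colour; `J` is a largest class of those `j` that choose the
same colours for all `x`. -/
theorem exists_rich_step [NeZero q] {w z t D : ℕ} (ht : t ≠ 0) (hD : 0 < D)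
    (hbig : 2 * (2 ^ r) ^ (w * D) * z ^ t * ((3 * q) ^ D * (2 * q ^ D)) ^ t < (2 ^ r) ^ t)
    (X : Finset L) (hX : #X ≤ D) (col : L → Finset (Fin r) → Finset (Fin r) → Fin q)
    (A : L → Finset (Finset (Fin r))) (hA : ∀ x ∈ X, 18 * D ≤ #(A x)) :
    ∃ (c : L → Fin q) (A' : L → Finset (Finset (Fin r))), (∀ x, A' x ⊆ A x) ∧
      (∀ x ∉ X, A' x = A x) ∧ (∀ x ∈ X, #(A x) ≤ 2 * (3 * q) ^ (D * t) * #(A' x)) ∧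
      Rich w z X col c A' := by
  have hq : 0 < q := NeZero.pos q
  let Bad : L → Finset (Finset (Fin r)) := fun x => {j | 3 * #{i ∈ A x | Hadamard j i} < #(A x)}
  have hBad : ∀ x ∈ X, 2 * D * #(Bad x) ≤ 2 ^ r := by
    intro x hx
    have h1 := card_deviating_mul_card_le (A x) (Bad x) fun i hi => Or.inl (mem_filter.mp hi).2
    have h2 := hA x hx
    have h3 : #(Bad x) * (18 * D) ≤ 9 * 2 ^ r := (Nat.mul_le_mul_left _ h2).trans h1
    have h4 : #(Bad x) * (18 * D) = 9 * (2 * D * #(Bad x)) := by ring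
    omega
  let Good : Finset (Finset (Fin r)) := univ \ X.biUnion Bad
  have hGood : 2 ^ r ≤ 2 * #Good := by
    have h1 : 2 * D * #(X.biUnion Bad) ≤ D * 2 ^ r := by
      calc 2 * D * #(X.biUnion Bad) ≤ 2 * D * ∑ x ∈ X, #(Bad x) := by
            gcongr
            exact card_biUnion_le
        _ = ∑ x ∈ X, 2 * D * #(Bad x) := mul_sum _ _ _
        _ ≤ #X * 2 ^ r := sum_le_card_nsmul _ _ _ hBad
        _ ≤ D * 2 ^ r := by gcongr
    have h2 : 2 * #(X.biUnion Bad) ≤ 2 ^ r := by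
      refine Nat.le_of_mul_le_mul_left ?_ hD
      linarith
    have h3 := le_card_sdiff (X.biUnion Bad) (univ : Finset (Finset (Fin r)))
    rw [card_univ, Fintype.card_finset, Fintype.card_fin] at h3
    change 2 ^ r - _ ≤ #Good at h3
    omega
  have hmaj : ∀ j ∈ Good, ∀ x : X, ∃ c : Fin q,
      #(A x) ≤ 3 * q * #{i ∈ A x | Hadamard i j ∧ col x i j = c} := by
    intro j hj x
    have h1 : #(A x) ≤ 3 * #{i ∈ A x | Hadamard i j} := by
      by_contra hlt
      refine (mem_sdiff.mp hj).2 (mem_biUnion.mpr ⟨x, x.2, mem_filter.mpr ⟨mem_univ _, ?_⟩⟩)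
      simp only [Hadamard.symm_iff (i := j)]
      omega
    by_contra hcon
    push Not at hcon
    have h2 : #{i ∈ A x | Hadamard i j} =
        ∑ c : Fin q, #{i ∈ A x | Hadamard i j ∧ col x i j = c} := by
      rw [card_eq_sum_card_fiberwise (f := fun i => col x i j) (t := univ) fun _ _ => mem_univ _]
      simp only [filter_filter]
    have h3 : ∑ c : Fin q, 3 * q * #{i ∈ A x | Hadamard i j ∧ col x i j = c} <
        ∑ c : Fin q, #(A x) :=
      sum_lt_sum_of_nonempty ⟨⟨0, hq⟩, mem_univ _⟩ fun c _ => hcon c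
    rw [← mul_sum, ← h2, sum_const, card_univ, Fintype.card_fin, smul_eq_mul] at h3
    have h4 : q * #(A x) ≤ q * (3 * #{i ∈ A x | Hadamard i j}) := Nat.mul_le_mul_left q h1
    linarith
  choose! cvec hcvec using hmaj
  obtain ⟨c, -, hc⟩ := exists_max_image (univ : Finset (X → Fin q))
    (fun c => #{j ∈ Good | cvec j = c}) ⟨fun _ => ⟨0, hq⟩, mem_univ _⟩
  set J : Finset (Finset (Fin r)) := {j ∈ Good | cvec j = c} with hJ
  have hJcard : 2 ^ r ≤ 2 * q ^ D * #J := by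
    have h1 : #Good ≤ q ^ #X * #J := by
      rw [card_eq_sum_card_fiberwise (f := cvec) (t := univ) fun _ _ => mem_univ _]
      refine (sum_le_card_nsmul _ _ _ hc).trans_eq ?_
      rw [card_univ, Fintype.card_fun, Fintype.card_fin, Fintype.card_coe, smul_eq_mul]
    have h2 : q ^ #X ≤ q ^ D := Nat.pow_le_pow_right hq hX
    calc 2 ^ r ≤ 2 * #Good := hGood
      _ ≤ 2 * (q ^ D * #J) := by
        gcongr
        exact h1.trans (Nat.mul_le_mul_right _ h2)
      _ = 2 * q ^ D * #J := by ring
  have hXc : Fintype.card X = #X := Fintype.card_coe X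
  obtain ⟨A', hA'sub, hA'card, hA'rich⟩ := exists_rich_subsets (ι := X) (fun x => A x) J
    (fun x i j => Hadamard i j ∧ col x i j = c x) (m := 3 * q) (t := t) (w := w) (z := z) ht
    (fun x => card_pos.mp (by have := hA x x.2; omega))
    (fun x j hj => by
      obtain ⟨hjG, hjc⟩ := mem_filter.mp hj
      have := hcvec j hjG x
      rwa [hjc] at this)
    (by
      rw [hXc, Fintype.card_finset, Fintype.card_fin]
      refine Nat.lt_of_mul_lt_mul_left (a := (2 * q ^ D) ^ t) ?_
      calc (2 * q ^ D) ^ t * (2 * (2 ^ r) ^ (w * #X) * z ^ t * (3 * q) ^ (#X * t))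
          ≤ (2 * q ^ D) ^ t * (2 * (2 ^ r) ^ (w * D) * z ^ t * (3 * q) ^ (D * t)) := by
            gcongr
            · exact Nat.one_le_two_pow
            · omega
        _ = 2 * (2 ^ r) ^ (w * D) * z ^ t * ((3 * q) ^ D * (2 * q ^ D)) ^ t := by
            rw [mul_pow ((3 * q) ^ D), ← pow_mul]; ring
        _ < (2 ^ r) ^ t := hbig
        _ ≤ (2 * q ^ D * #J) ^ t := Nat.pow_le_pow_left hJcard t
        _ = (2 * q ^ D) ^ t * #J ^ t := by rw [mul_pow])
  refine ⟨fun x => if hx : x ∈ X then c ⟨x, hx⟩ else ⟨0, hq⟩,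
    fun x => if hx : x ∈ X then A' ⟨x, hx⟩ else A x, fun x => ?_, fun x hx => ?_, fun x hx => ?_,
    fun S hS => ?_⟩
  · dsimp only
    split_ifs with hx
    · exact hA'sub ⟨x, hx⟩
    · exact Subset.rfl
  · exact dif_neg hx
  · dsimp only
    rw [dif_pos hx]
    refine (hA'card ⟨x, hx⟩).trans ?_
    rw [hXc]
    gcongr
    omega
  · refine (hA'rich (fun x => S x) fun x l => ?_).trans_le (card_le_card ?_)
    · have := hS x x.2 l
      dsimp only at this
      rwa [dif_pos x.2] at this
    · intro j hj
      refine mem_filter.mpr ⟨mem_univ _, fun x hx l => ?_⟩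
      dsimp only
      rw [dif_pos hx]
      exact (mem_filter.mp hj).2 ⟨x, hx⟩ l

/-- Making all right vertices in `Y` rich, one after the other: richness survives shrinking, so each
`A x` only pays for the right vertices adjacent to `x`. -/
theorem exists_rich [NeZero q] {w z t D d : ℕ} (ht : t ≠ 0) (hD : 0 < D)
    (hbig : 2 * (2 ^ r) ^ (w * D) * z ^ t * ((3 * q) ^ D * (2 * q ^ D)) ^ t < (2 ^ r) ^ t)
    (hsize : (2 * (3 * q) ^ (D * t)) ^ d * (18 * D) ≤ 2 ^ r)
    (nbr : R → Finset L) (col : R → L → Finset (Fin r) → Finset (Fin r) → Fin q) (Y : Finset R)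
    (hY : ∀ y ∈ Y, #(nbr y) ≤ D) (hd : ∀ x, #{y ∈ Y | x ∈ nbr y} ≤ d) :
    ∃ (c : R → L → Fin q) (A : L → Finset (Finset (Fin r))),
      (∀ x, 2 ^ r ≤ (2 * (3 * q) ^ (D * t)) ^ d * #(A x)) ∧
      ∀ y ∈ Y, Rich w z (nbr y) (col y) (c y) A := by
  have hq : 0 < q := NeZero.pos q
  set Θ := 2 * (3 * q) ^ (D * t) with hΘ
  have hΘpos : 0 < Θ := by positivity
  suffices h : ∀ Y' ⊆ Y, ∃ (c : R → L → Fin q) (A : L → Finset (Finset (Fin r))),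
      (∀ x, 2 ^ r ≤ Θ ^ #{y ∈ Y' | x ∈ nbr y} * #(A x)) ∧
      ∀ y ∈ Y', Rich w z (nbr y) (col y) (c y) A by
    obtain ⟨c, A, hA, hrich⟩ := h Y Subset.rfl
    refine ⟨c, A, fun x => (hA x).trans ?_, hrich⟩
    exact Nat.mul_le_mul_right _ (Nat.pow_le_pow_right hΘpos (hd x))
  intro Y'
  induction Y' using Finset.induction_on with
  | empty =>
    intro _
    exact ⟨fun _ _ => ⟨0, hq⟩, fun _ => univ, by simp, by simp⟩
  | insert y Y' hy ih =>
    intro hsub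
    obtain ⟨c, A, hA, hrich⟩ := ih ((subset_insert y Y').trans hsub)
    have hlarge : ∀ x ∈ nbr y, 18 * D ≤ #(A x) := by
      intro x _
      have h1 : #{y ∈ Y' | x ∈ nbr y} ≤ d :=
        (card_le_card (filter_subset_filter _ ((subset_insert y Y').trans hsub))).trans (hd x)
      refine Nat.le_of_mul_le_mul_left (hsize.trans ((hA x).trans ?_)) (pow_pos hΘpos d)
      exact Nat.mul_le_mul_right _ (Nat.pow_le_pow_right hΘpos h1)
    obtain ⟨cy, A', hsubA, hout, hin, hrich'⟩ := exists_rich_step ht hD hbig (nbr y)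
      (hY y (hsub (mem_insert_self y Y'))) (col y) A hlarge
    refine ⟨Function.update c y cy, A', fun x => ?_, fun y' hy' => ?_⟩
    · rw [filter_insert]
      split_ifs with hx
      · rw [card_insert_of_notMem (fun h => hy (mem_filter.mp h).1), pow_succ, mul_assoc]
        exact (hA x).trans (Nat.mul_le_mul_left _ (hin x hx))
      · rw [hout x hx]
        exact hA x
    · rcases mem_insert.mp hy' with rfl | hy'
      · rw [Function.update_self]
        exact hrich'
      · rw [Function.update_of_ne (ne_of_mem_of_not_mem hy' hy)]
        exact (hrich y' hy').mono hsubA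

end Cleaning

/-! ### Common non-neighbours of random elements -/

section Transversal

/-- If for every point of a product only a proportion `1 / g` of the values of the coordinate `e`
leads into an event, then the event has proportion at most `1 / g`. -/
theorem card_filter_mul_le_of_update {I B : Type*} [Fintype I] [DecidableEq I] [DecidableEq B]
    (A : I → Finset B) (hA : ∀ e, (A e).Nonempty) (e : I) (P : (I → B) → Prop) [DecidablePred P]
    (g : ℕ)
    (hP : ∀ S ∈ Fintype.piFinset A, #{v ∈ A e | P (Function.update S e v)} * g ≤ #(A e)) :
    #{S ∈ Fintype.piFinset A | P S} * g ≤ #(Fintype.piFinset A) := by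
  have hswap : #{S ∈ Fintype.piFinset A | P S} * #(A e) =
      ∑ S ∈ Fintype.piFinset A, #{v ∈ A e | P (Function.update S e v)} := by
    rw [← card_product, ← card_sigma]
    refine card_bij' (fun p _ => ⟨Function.update p.1 e p.2, p.1 e⟩)
      (fun s _ => (Function.update s.1 e s.2, s.1 e)) ?_ ?_ ?_ ?_
    · rintro ⟨S, v⟩ h
      simp only [mem_product, mem_filter, Fintype.mem_piFinset, mem_sigma] at h ⊢
      refine ⟨fun a => ?_, h.1.1 e, by simpa using h.1.2⟩
      rcases eq_or_ne a e with rfl | ha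
      · simpa using h.2
      · simpa [Function.update_of_ne ha] using h.1.1 a
    · rintro ⟨S, v⟩ h
      simp only [mem_product, mem_filter, Fintype.mem_piFinset, mem_sigma] at h ⊢
      refine ⟨⟨fun a => ?_, h.2.2⟩, h.1 e⟩
      rcases eq_or_ne a e with rfl | ha
      · simpa using h.2.1
      · simpa [Function.update_of_ne ha] using h.1 a
    · rintro ⟨S, v⟩ _
      simp
    · rintro ⟨S, v⟩ _
      simp
  refine Nat.le_of_mul_le_mul_right ?_ (hA e).card_pos
  calc #{S ∈ Fintype.piFinset A | P S} * g * #(A e)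
      = (∑ S ∈ Fintype.piFinset A, #{v ∈ A e | P (Function.update S e v)}) * g := by
        rw [← hswap]; ring
    _ = ∑ S ∈ Fintype.piFinset A, #{v ∈ A e | P (Function.update S e v)} * g := sum_mul _ _ _
    _ ≤ #(Fintype.piFinset A) * #(A e) := sum_le_card_nsmul _ _ _ hP

/-- Random elements have many common non-neighbours inside a set `Z S` that does not depend on
them: each new one is unlikely to destroy more than two thirds of what is left. -/
theorem card_few_nonneighbours_mul_le {I : Type*} [Fintype I] [DecidableEq I] {r : ℕ}
    (A : I → Finset (Finset (Fin r))) (hA : ∀ e, (A e).Nonempty) {z g m : ℕ}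
    (Z : (I → Finset (Fin r)) → Finset (Finset (Fin r)))
    (hZ : ∀ S ∈ Fintype.piFinset A, z ≤ #(Z S)) (ρ : Finset I)
    (hZρ : ∀ S, ∀ e ∈ ρ, ∀ v, Z (Function.update S e v) = Z S) (hρ : #ρ ≤ m)
    (hbig : ∀ e, 9 * 2 ^ r * g * 3 ^ m ≤ #(A e) * z) :
    #{S ∈ Fintype.piFinset A | 3 ^ #ρ * #{j ∈ Z S | ∀ e ∈ ρ, ¬ Hadamard (S e) j} < z} * g ≤
      #ρ * #(Fintype.piFinset A) := by
  induction ρ using Finset.induction_on with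
  | empty =>
    have : ({S ∈ Fintype.piFinset A | 3 ^ #(∅ : Finset I) *
        #{j ∈ Z S | ∀ e ∈ (∅ : Finset I), ¬ Hadamard (S e) j} < z} : Finset _) = ∅ := by
      refine filter_eq_empty_iff.mpr fun S hS => ?_
      simpa using hZ S hS
    rw [this]
    simp
  | insert e ρ he ih =>
    have hρm : #ρ + 1 ≤ m := by rwa [card_insert_of_notMem he] at hρ
    have ih' := ih (fun S e' he' => hZρ S e' (mem_insert_of_mem he')) (by omega)
    let N : (I → Finset (Fin r)) → Finset (Finset (Fin r)) := fun S =>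
      {j ∈ Z S | ∀ e ∈ ρ, ¬ Hadamard (S e) j}
    have hN : ∀ S v, N (Function.update S e v) = N S := by
      intro S v
      simp only [N]
      rw [hZρ S e (mem_insert_self e ρ) v]
      refine filter_congr fun j _ => forall₂_congr fun e' he' => ?_
      rw [Function.update_of_ne (by rintro rfl; exact he he')]
    have hsplit : ∀ S, ({j ∈ Z S | ∀ e' ∈ insert e ρ, ¬ Hadamard (S e') j} : Finset _) =
        {j ∈ N S | ¬ Hadamard (S e) j} := by
      intro S
      ext j
      simp only [N, mem_filter, forall_mem_insert]
      tauto
    have hnew := card_filter_mul_le_of_update A hA e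
      (fun S => z ≤ 3 ^ #ρ * #(N S) ∧ 3 ^ (#ρ + 1) * #{j ∈ N S | ¬ Hadamard (S e) j} < z) g (by
        intro S hS
        simp only [hN, Function.update_self]
        by_cases hz : z ≤ 3 ^ #ρ * #(N S)
        · have hdev := card_deviating_mul_card_le (N S)
            {v ∈ A e | z ≤ 3 ^ #ρ * #(N S) ∧ 3 ^ (#ρ + 1) * #{j ∈ N S | ¬ Hadamard v j} < z}
            (fun v hv => Or.inr (by
              have h1 := (mem_filter.mp hv).2
              have h2 : 3 ^ #ρ * (3 * #{j ∈ N S | ¬ Hadamard v j}) < 3 ^ #ρ * #(N S) := by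
                have : 3 ^ (#ρ + 1) * #{j ∈ N S | ¬ Hadamard v j} =
                  3 ^ #ρ * (3 * #{j ∈ N S | ¬ Hadamard v j}) := by ring
                omega
              exact Nat.lt_of_mul_lt_mul_left h2))
          set b := #{v ∈ A e | z ≤ 3 ^ #ρ * #(N S) ∧
            3 ^ (#ρ + 1) * #{j ∈ N S | ¬ Hadamard v j} < z}
          have h3 : z ≤ 3 ^ m * #(N S) :=
            hz.trans (Nat.mul_le_mul_right _ (Nat.pow_le_pow_right (by norm_num) (by omega)))
          rcases Nat.eq_zero_or_pos (#(N S)) with h0 | hpos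
          · have hb : b = 0 := by
              refine card_eq_zero.mpr (filter_eq_empty_iff.mpr fun v _ hv => ?_)
              rw [h0] at hv
              omega
            simp [hb]
          · refine Nat.le_of_mul_le_mul_right (c := 3 ^ m * #(N S)) ?_ (by positivity)
            calc b * g * (3 ^ m * #(N S)) = b * #(N S) * (g * 3 ^ m) := by ring
              _ ≤ 9 * 2 ^ r * (g * 3 ^ m) := by gcongr
              _ = 9 * 2 ^ r * g * 3 ^ m := by ring
              _ ≤ #(A e) * z := hbig e
              _ ≤ #(A e) * (3 ^ m * #(N S)) := by gcongr
        · simp [hz])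
    have hcover : ({S ∈ Fintype.piFinset A | 3 ^ #(insert e ρ) *
          #{j ∈ Z S | ∀ e' ∈ insert e ρ, ¬ Hadamard (S e') j} < z} : Finset _) ⊆
        {S ∈ Fintype.piFinset A | 3 ^ #ρ * #(N S) < z} ∪
        {S ∈ Fintype.piFinset A | z ≤ 3 ^ #ρ * #(N S) ∧
          3 ^ (#ρ + 1) * #{j ∈ N S | ¬ Hadamard (S e) j} < z} := by
      intro S hS
      rw [mem_filter, hsplit, card_insert_of_notMem he] at hS
      rw [mem_union, mem_filter, mem_filter]
      by_cases hz : z ≤ 3 ^ #ρ * #(N S)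
      · exact Or.inr ⟨hS.1, hz, hS.2⟩
      · exact Or.inl ⟨hS.1, not_le.mp hz⟩
    calc _ ≤ (#{S ∈ Fintype.piFinset A | 3 ^ #ρ * #(N S) < z} +
          #{S ∈ Fintype.piFinset A | z ≤ 3 ^ #ρ * #(N S) ∧
            3 ^ (#ρ + 1) * #{j ∈ N S | ¬ Hadamard (S e) j} < z}) * g := by
          gcongr
          exact (card_le_card hcover).trans (card_union_le _ _)
      _ ≤ #ρ * #(Fintype.piFinset A) + #(Fintype.piFinset A) := by
          rw [add_mul]
          exact Nat.add_le_add ih' hnew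
      _ = #(insert e ρ) * #(Fintype.piFinset A) := by
          rw [card_insert_of_notMem he]; ring

end Transversal

/-! ### Flexible choices -/

section Flexible

variable {L R : Type*} [Fintype L] [DecidableEq L] {r q w : ℕ}

/-- The chosen elements `S (x, l)`, `x ∈ X`, are flexible towards a blob: whichever of them are
prescribed to be neighbours, in the colours `c`, the others being non-neighbours, at least `w`
elements of the blob comply. -/
def Flexible (X : Finset L) (col : L → Finset (Fin r) → Finset (Fin r) → Fin q) (c : L → Fin q)
    (S : L × Fin w → Finset (Fin r)) : Prop :=
  ∀ σ ⊆ X ×ˢ univ, w ≤ #{j | (∀ e ∈ σ, Hadamard (S e) j ∧ col e.1 (S e) j = c e.1) ∧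
    ∀ e ∈ (X ×ˢ univ) \ σ, ¬ Hadamard (S e) j}

open scoped Classical in
/-- Richness makes random elements flexible: the prescribed neighbours always have many common
neighbours, and random further elements miss a fair share of those. -/
theorem Rich.card_not_flexible_mul_le {z D : ℕ} (hD : 0 < D) (hw : 0 < w) {X : Finset L}
    (hX : #X ≤ D) {col : L → Finset (Fin r) → Finset (Fin r) → Fin q} {c : L → Fin q}
    {A : L → Finset (Finset (Fin r))} (hrich : Rich w z X col c A) (hA : ∀ x, (A x).Nonempty)
    (hbig : ∀ x, 9 * 2 ^ r * (2 ^ (D * w) * (D * w) * 256) * 3 ^ (D * w) ≤ #(A x) * z)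
    (hz : 3 ^ (D * w) * w ≤ z) :
    #{S ∈ Fintype.piFinset fun e : L × Fin w => A e.1 | ¬ Flexible X col c S} * 256 ≤
      #(Fintype.piFinset fun e : L × Fin w => A e.1) := by
  set Ω := Fintype.piFinset fun e : L × Fin w => A e.1 with hΩ
  set U : Finset (L × Fin w) := X ×ˢ univ with hU
  have hUcard : #U ≤ D * w := by
    rw [hU, card_product, card_univ, Fintype.card_fin]
    gcongr
  set g := 2 ^ (D * w) * (D * w) * 256 with hg
  let Z : Finset (L × Fin w) → (L × Fin w → Finset (Fin r)) → Finset (Finset (Fin r)) :=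
    fun σ S => {j | ∀ e ∈ σ, Hadamard (S e) j ∧ col e.1 (S e) j = c e.1}
  let Few : Finset (L × Fin w) → Finset (L × Fin w → Finset (Fin r)) := fun σ =>
    {S ∈ Ω | 3 ^ #(U \ σ) * #{j ∈ Z σ S | ∀ e ∈ U \ σ, ¬ Hadamard (S e) j} < z}
  have hFew : ∀ σ ∈ U.powerset, #(Few σ) * g ≤ D * w * #Ω := by
    intro σ hσ
    have hσU := mem_powerset.mp hσ
    have hcard : #(U \ σ) ≤ D * w := (card_le_card sdiff_subset).trans hUcard
    refine (card_few_nonneighbours_mul_le (fun e : L × Fin w => A e.1) (fun e => hA e.1)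
      (z := z) (g := g) (m := D * w) (Z σ) (fun S hS => ?_) (U \ σ) (fun S e he v => ?_) hcard
      (fun e => hbig e.1)).trans (Nat.mul_le_mul_right _ hcard)
    · refine ((hrich (fun x l => S (x, l)) fun x _ l => ?_).trans_le (card_le_card ?_)).le
      · exact Fintype.mem_piFinset.mp hS (x, l)
      · intro j hj
        refine mem_filter.mpr ⟨mem_univ _, fun e he => ?_⟩
        exact (mem_filter.mp hj).2 e.1 (mem_product.mp (hσU he)).1 e.2
    · refine filter_congr fun j _ => forall₂_congr fun e' he' => ?_
      rw [Function.update_of_ne (ne_of_mem_of_not_mem he' (mem_sdiff.mp he).2)]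
  have hcover : ({S ∈ Ω | ¬ Flexible X col c S} : Finset _) ⊆ U.powerset.biUnion Few := by
    intro S hS
    obtain ⟨hSΩ, hS⟩ := mem_filter.mp hS
    unfold Flexible at hS
    push Not at hS
    obtain ⟨σ, hσ, hlt⟩ := hS
    refine mem_biUnion.mpr ⟨σ, mem_powerset.mpr hσ, mem_filter.mpr ⟨hSΩ, ?_⟩⟩
    have h1 : #(U \ σ) ≤ D * w := (card_le_card sdiff_subset).trans hUcard
    rw [filter_filter]
    calc _ < 3 ^ #(U \ σ) * w := Nat.mul_lt_mul_of_pos_left hlt (by positivity)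
      _ ≤ 3 ^ (D * w) * w := by gcongr; norm_num
      _ ≤ z := hz
  refine Nat.le_of_mul_le_mul_right (c := 2 ^ (D * w) * (D * w)) ?_ (by positivity)
  calc #{S ∈ Ω | ¬ Flexible X col c S} * 256 * (2 ^ (D * w) * (D * w))
      = #{S ∈ Ω | ¬ Flexible X col c S} * g := by rw [hg]; ring
    _ ≤ (∑ σ ∈ U.powerset, #(Few σ)) * g := by
        gcongr
        exact (card_le_card hcover).trans card_biUnion_le
    _ = ∑ σ ∈ U.powerset, #(Few σ) * g := sum_mul _ _ _
    _ ≤ #U.powerset * (D * w * #Ω) := sum_le_card_nsmul _ _ _ hFew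
    _ ≤ 2 ^ (D * w) * (D * w * #Ω) := by
        rw [card_powerset]
        gcongr
        norm_num
    _ = #Ω * (2 ^ (D * w) * (D * w)) := by ring

/-- One choice of elements that is flexible towards all but few of the rich right vertices. -/
theorem exists_mostly_flexible {z D : ℕ} (hD : 0 < D) (hw : 0 < w) (nbr : R → Finset L)
    (col : R → L → Finset (Fin r) → Finset (Fin r) → Fin q) (c : R → L → Fin q)
    (A : L → Finset (Finset (Fin r))) (Y : Finset R) (hY : ∀ y ∈ Y, #(nbr y) ≤ D)
    (hrich : ∀ y ∈ Y, Rich w z (nbr y) (col y) (c y) A)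
    (hbig : ∀ x, 9 * 2 ^ r * (2 ^ (D * w) * (D * w) * 256) * 3 ^ (D * w) ≤ #(A x) * z)
    (hz : 3 ^ (D * w) * w ≤ z) :
    ∃ (S : L × Fin w → Finset (Fin r)) (Bad : Finset R), Bad ⊆ Y ∧ 256 * #Bad ≤ #Y ∧
      ∀ y ∈ Y, y ∉ Bad → Flexible (nbr y) (col y) (c y) S := by
  classical
  have hA : ∀ x, (A x).Nonempty := by
    intro x
    refine card_pos.mp (Nat.pos_of_ne_zero fun h0 => ?_)
    have h1 := hbig x
    rw [h0, zero_mul] at h1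
    have h2 : 0 < 9 * 2 ^ r * (2 ^ (D * w) * (D * w) * 256) * 3 ^ (D * w) := by positivity
    omega
  set Ω := Fintype.piFinset fun e : L × Fin w => A e.1 with hΩ
  have hΩne : Ω.Nonempty := Fintype.piFinset_nonempty.mpr fun e => hA e.1
  obtain ⟨S, -, hS⟩ : ∃ S ∈ Ω, 256 * #{y ∈ Y | ¬ Flexible (nbr y) (col y) (c y) S} ≤ #Y := by
    refine exists_le_of_sum_le hΩne ?_
    calc ∑ S ∈ Ω, 256 * #{y ∈ Y | ¬ Flexible (nbr y) (col y) (c y) S}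
        = ∑ y ∈ Y, #{S ∈ Ω | ¬ Flexible (nbr y) (col y) (c y) S} * 256 := by
          rw [← mul_sum, ← sum_mul, mul_comm]
          simp only [card_filter]
          rw [sum_comm]
      _ ≤ #Y * #Ω := sum_le_card_nsmul _ _ _ fun y hy =>
          (hrich y hy).card_not_flexible_mul_le hD hw (hY y hy) hA hbig hz
      _ = ∑ S ∈ Ω, #Y := by rw [sum_const, smul_eq_mul, mul_comm]
  refine ⟨S, {y ∈ Y | ¬ Flexible (nbr y) (col y) (c y) S}, filter_subset _ _, hS,
    fun y hy hyB => ?_⟩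
  by_contra hf
  exact hyB (mem_filter.mpr ⟨hy, hf⟩)

end Flexible

/-! ### Trees in dense parts of locally sparse graphs -/

section Expansion

/-- A multigraph with more than `s` times as many edges as vertices has a nonempty part in which
all degrees are at least `s`. -/
theorem exists_minDegree_part {V P : Type*} [Fintype V] [DecidableEq V] (Q : Finset P)
    (a b : P → V) {s : ℕ} (h : s * Fintype.card V < #Q) :
    ∃ U : Finset V, U.Nonempty ∧
      ∀ v ∈ U, s ≤ #{p ∈ Q | (a p ∈ U ∧ b p ∈ U) ∧ (a p = v ∨ b p = v)} := by
  classical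
  obtain ⟨U, hU, hmin⟩ := exists_min_image
    ({U | s * #U < #{p ∈ Q | a p ∈ U ∧ b p ∈ U}} : Finset (Finset V)) card
    ⟨univ, by simpa using h⟩
  have hU := (mem_filter.mp hU).2
  refine ⟨U, ?_, fun v hv => ?_⟩
  · by_contra hne
    rw [not_nonempty_iff_eq_empty] at hne
    subst hne
    simp at hU
  · by_contra hlt
    have h1 : U.erase v ∉ ({U | s * #U < #{p ∈ Q | a p ∈ U ∧ b p ∈ U}} : Finset (Finset V)) :=
      fun hmem => by
        have h2 := hmin _ hmem
        have h3 := card_erase_lt_of_mem hv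
        omega
    rw [mem_filter, not_and, not_lt] at h1
    have h2 := h1 (mem_univ _)
    have h3 : ({p ∈ Q | a p ∈ U ∧ b p ∈ U} : Finset P) ⊆
        {p ∈ Q | a p ∈ U.erase v ∧ b p ∈ U.erase v} ∪
          {p ∈ Q | (a p ∈ U ∧ b p ∈ U) ∧ (a p = v ∨ b p = v)} := by
      intro p hp
      simp only [mem_union, mem_filter, mem_erase] at hp ⊢
      tauto
    have h4 := (card_le_card h3).trans (card_union_le _ _)
    have h5 := card_pos.mpr ⟨v, hv⟩
    rw [card_erase_of_mem hv] at h2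
    have h6 : s * #U = s * (#U - 1) + s := by
      rw [← Nat.mul_succ]
      congr 1
      omega
    omega

/-- A part of a locally sparse bipartite multigraph in which all degrees are at least
`2 * (K + 1)` expands small sets by the factor `K`, so by the Friedman–Pippenger theorem it
contains all small trees of maximum degree less than `K`. -/
theorem exists_tree_in_dense_part {W : Type*} [Fintype W] {T : SimpleGraph W}
    [DecidableRel T.Adj] (hT : T.IsTree) {k N d s : ℕ} (hk : T.maxDegree ≤ k)
    (hN : (k + 1) * (2 * Fintype.card W) ≤ N) (f : Fin N × Fin d → Fin N)
    (hLR : ∀ X Y : Finset (Fin N), 1 ≤ #X → #X ≤ 2 * Fintype.card W → #Y = (k + 1) * #X →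
      #{p ∈ X ×ˢ univ | f p ∈ Y} < s * #X)
    (hRL : ∀ X Y : Finset (Fin N), 1 ≤ #Y → #Y ≤ 2 * Fintype.card W → #X = (k + 1) * #Y →
      #{p ∈ X ×ˢ univ | f p ∈ Y} < s * #Y)
    (Q : Finset (Fin N × Fin d)) (hQ : s * (2 * N) < #Q) :
    ∃ ψ : W → Fin N ⊕ Fin N, Function.Injective ψ ∧ ∀ u v, T.Adj u v →
      ∃ p ∈ Q, (ψ u = Sum.inl p.1 ∧ ψ v = Sum.inr (f p)) ∨
        (ψ v = Sum.inl p.1 ∧ ψ u = Sum.inr (f p)) := by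
  classical
  obtain ⟨U, hUne, hU⟩ := exists_minDegree_part Q (fun p => (Sum.inl p.1 : Fin N ⊕ Fin N))
    (fun p => Sum.inr (f p)) (s := s) (by
      rw [Fintype.card_sum, Fintype.card_fin]
      rwa [← two_mul])
  let Q' : Finset (Fin N × Fin d) := {p ∈ Q | Sum.inl p.1 ∈ U ∧ Sum.inr (f p) ∈ U}
  let nbr : Fin N ⊕ Fin N → Finset (Fin N ⊕ Fin N) := fun v =>
    {u | ∃ p ∈ Q', (v = Sum.inl p.1 ∧ u = Sum.inr (f p)) ∨ (u = Sum.inl p.1 ∧ v = Sum.inr (f p))}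
  have hl : ∀ x, Sum.inl x ∈ U → s ≤ #{p ∈ Q' | p.1 = x} := by
    intro x hx
    refine (hU _ hx).trans (card_le_card fun p hp => ?_)
    simpa [Q', and_assoc] using hp
  have hr : ∀ y, Sum.inr y ∈ U → s ≤ #{p ∈ Q' | f p = y} := by
    intro y hy
    refine (hU _ hy).trans (card_le_card fun p hp => ?_)
    simpa [Q', and_assoc] using hp
  have hexpL : ∀ X : Finset (Fin N), X.map Function.Embedding.inl ⊆ U →
      #X ≤ 2 * Fintype.card W → (k + 1) * #X ≤ #{y | ∃ p ∈ Q', p.1 ∈ X ∧ f p = y} := by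
    intro X hX hXc
    by_contra! hlt
    have hpos : 1 ≤ #X := Nat.pos_of_ne_zero fun h0 => by simp [h0] at hlt
    obtain ⟨Y, hsub, hYc⟩ := exists_superset_card_eq hlt.le
      (by rw [Fintype.card_fin]; exact (Nat.mul_le_mul_left _ hXc).trans hN)
    refine absurd (hLR X Y hpos hXc hYc) (not_lt.mpr ?_)
    calc s * #X = ∑ x ∈ X, s := by rw [sum_const, smul_eq_mul, mul_comm]
      _ ≤ ∑ x ∈ X, #{p ∈ Q' | p.1 = x} :=
        sum_le_sum fun x hx => hl x (hX (mem_map_of_mem _ hx))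
      _ = #{p ∈ Q' | p.1 ∈ X} :=
        sum_card_fiberwise_eq_card_filter Q' X Prod.fst
      _ ≤ #{p ∈ X ×ˢ univ | f p ∈ Y} := by
        refine card_le_card fun p hp => ?_
        obtain ⟨h1, h2⟩ := mem_filter.mp hp
        exact mem_filter.mpr ⟨mem_product.mpr ⟨h2, mem_univ _⟩,
          hsub (mem_filter.mpr ⟨mem_univ _, p, h1, h2, rfl⟩)⟩
  have hexpR : ∀ Y : Finset (Fin N), Y.map Function.Embedding.inr ⊆ U →
      #Y ≤ 2 * Fintype.card W → (k + 1) * #Y ≤ #{x | ∃ p ∈ Q', f p ∈ Y ∧ p.1 = x} := by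
    intro Y hY hYc
    by_contra! hlt
    have hpos : 1 ≤ #Y := Nat.pos_of_ne_zero fun h0 => by simp [h0] at hlt
    obtain ⟨X, hsub, hXc⟩ := exists_superset_card_eq hlt.le
      (by rw [Fintype.card_fin]; exact (Nat.mul_le_mul_left _ hYc).trans hN)
    refine absurd (hRL X Y hpos hYc hXc) (not_lt.mpr ?_)
    calc s * #Y = ∑ y ∈ Y, s := by rw [sum_const, smul_eq_mul, mul_comm]
      _ ≤ ∑ y ∈ Y, #{p ∈ Q' | f p = y} :=
        sum_le_sum fun y hy => hr y (hY (mem_map_of_mem _ hy))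
      _ = #{p ∈ Q' | f p ∈ Y} :=
        sum_card_fiberwise_eq_card_filter Q' Y f
      _ ≤ #{p ∈ X ×ˢ univ | f p ∈ Y} := by
        refine card_le_card fun p hp => ?_
        obtain ⟨h1, h2⟩ := mem_filter.mp hp
        exact mem_filter.mpr ⟨mem_product.mpr
          ⟨hsub (mem_filter.mpr ⟨mem_univ _, p, h1, h2, rfl⟩), mem_univ _⟩, h2⟩
  obtain ⟨ψ, hinj, hψ⟩ := exists_tree_embedding hT hk hUne (nbr := nbr) (fun v u hu => by
      obtain ⟨p, hp, h | h⟩ := (mem_filter.mp hu).2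
      · exact h.2 ▸ (mem_filter.mp hp).2.2
      · exact h.1 ▸ (mem_filter.mp hp).2.1)
    (fun v u hu => by
      obtain ⟨p, hp, h⟩ := (mem_filter.mp hu).2
      exact mem_filter.mpr ⟨mem_univ _, p, hp, h.symm⟩)
    (fun X hX hXc => by
      have hsplit : #X.toLeft + #X.toRight = #X := card_toLeft_add_card_toRight
      have h1 := hexpL X.toLeft
        (fun v hv => by obtain ⟨x, hx, rfl⟩ := mem_map.mp hv; exact hX (mem_toLeft.mp hx)) (by omega)
      have h2 := hexpR X.toRight
        (fun v hv => by obtain ⟨x, hx, rfl⟩ := mem_map.mp hv; exact hX (mem_toRight.mp hx)) (by omega)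
      have h3 : ({y | ∃ p ∈ Q', p.1 ∈ X.toLeft ∧ f p = y} : Finset (Fin N)) ⊆
          (X.biUnion nbr).toRight := by
        intro y hy
        obtain ⟨p, hp, hpX, rfl⟩ := (mem_filter.mp hy).2
        exact mem_toRight.mpr (mem_biUnion.mpr ⟨_, mem_toLeft.mp hpX,
          mem_filter.mpr ⟨mem_univ _, p, hp, Or.inl ⟨rfl, rfl⟩⟩⟩)
      have h4 : ({x | ∃ p ∈ Q', f p ∈ X.toRight ∧ p.1 = x} : Finset (Fin N)) ⊆
          (X.biUnion nbr).toLeft := by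
        intro x hx
        obtain ⟨p, hp, hpX, rfl⟩ := (mem_filter.mp hx).2
        exact mem_toLeft.mpr (mem_biUnion.mpr ⟨_, mem_toRight.mp hpX,
          mem_filter.mpr ⟨mem_univ _, p, hp, Or.inr ⟨rfl, rfl⟩⟩⟩)
      have h5 := card_toLeft_add_card_toRight (u := X.biUnion nbr)
      have h6 := card_le_card h3
      have h7 := card_le_card h4
      rw [← hsplit, mul_add]
      omega)
  refine ⟨ψ, hinj, fun u v huv => ?_⟩
  obtain ⟨p, hp, h⟩ := (mem_filter.mp (hψ u v huv)).2
  exact ⟨p, (mem_filter.mp hp).1, h⟩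

end Expansion

/-! ### Lifting tree embeddings to the host graph -/

section Host

variable {N d r q w : ℕ}

/-- The host graph: the bipartite graph in which `f (x, i)` is the `i`-th neighbour of the left
vertex `x`, with every vertex replaced by a blob indexed by `Finset (Fin r)` and every edge by a
copy of the Hadamard graph. -/
def hostGraph (f : Fin N × Fin d → Fin N) (r : ℕ) :
    SimpleGraph ((Fin N ⊕ Fin N) × Finset (Fin r)) where
  Adj
    | (Sum.inl x, i), (Sum.inr y, j) => (∃ l, f (x, l) = y) ∧ Hadamard i j
    | (Sum.inr y, j), (Sum.inl x, i) => (∃ l, f (x, l) = y) ∧ Hadamard i j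
    | (Sum.inl _, _), (Sum.inl _, _) => False
    | (Sum.inr _, _), (Sum.inr _, _) => False
  symm := ⟨by rintro ⟨x | x, i⟩ ⟨y | y, j⟩ h <;> exact h⟩
  loopless := ⟨by rintro ⟨x | x, i⟩ h <;> exact h⟩

theorem encard_edgeSet_hostGraph_le (f : Fin N × Fin d → Fin N) (r : ℕ) :
    (hostGraph f r).edgeSet.encard ≤ (N * d * (2 ^ r * 2 ^ r) : ℕ) := by
  let e : (Fin N × Fin d) × (Finset (Fin r) × Finset (Fin r)) →
      Sym2 ((Fin N ⊕ Fin N) × Finset (Fin r)) := fun p =>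
    s((Sum.inl p.1.1, p.2.1), (Sum.inr (f p.1), p.2.2))
  have hsub : (hostGraph f r).edgeSet ⊆ e '' Set.univ := by
    intro a
    induction a using Sym2.ind with
    | _ u v =>
      obtain ⟨x | x, i⟩ := u <;> obtain ⟨y | y, j⟩ := v <;> intro h
      · exact h.elim
      · obtain ⟨⟨l, rfl⟩, -⟩ := h
        exact ⟨((x, l), (i, j)), trivial, rfl⟩
      · obtain ⟨⟨l, rfl⟩, -⟩ := h
        exact ⟨((y, l), (j, i)), trivial, Sym2.eq_swap⟩
      · exact h.elim
  refine (Set.encard_le_encard hsub).trans ((Set.encard_image_le _ _).trans_eq ?_)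
  rw [Set.encard_univ, ENat.card_eq_coe_fintype_card]
  simp

/-- Distinct representatives for at most `m` sets that all have at least `m` elements. -/
theorem exists_injOn_mem {α B : Type*} [DecidableEq α] [DecidableEq B] (s : Finset α)
    (Z : α → Finset B) (b₀ : B) (h : ∀ a ∈ s, #s ≤ #(Z a)) :
    ∃ g : α → B, Set.InjOn g s ∧ ∀ a ∈ s, g a ∈ Z a := by
  induction s using Finset.induction_on with
  | empty => exact ⟨fun _ => b₀, by simp, by simp⟩
  | insert a s ha ih =>
    rw [card_insert_of_notMem ha] at h
    obtain ⟨g, hg, hgZ⟩ := ih fun b hb => by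
      have := h b (mem_insert_of_mem hb)
      omega
    obtain ⟨b, hb⟩ : (Z a \ s.image g).Nonempty := by
      refine card_pos.mp ?_
      have h1 := le_card_sdiff (s.image g) (Z a)
      have h2 := card_image_le (s := s) (f := g)
      have h3 := h a (mem_insert_self a s)
      omega
    obtain ⟨hbZ, hbs⟩ := mem_sdiff.mp hb
    have hupd : ∀ c ∈ s, Function.update g a b c = g c := fun c hc =>
      Function.update_of_ne (ne_of_mem_of_not_mem hc ha) _ _
    refine ⟨Function.update g a b, ?_, fun c hc => ?_⟩
    · rw [coe_insert]
      refine (Set.injOn_insert (by simpa using ha)).mpr ⟨hg.congr fun c hc => (hupd c hc).symm, ?_⟩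
      rintro ⟨c, hc, hcb⟩
      rw [Function.update_self, hupd c hc] at hcb
      exact hbs (hcb ▸ mem_image_of_mem g hc)
    · rcases mem_insert.mp hc with rfl | hc
      · rwa [Function.update_self]
      · rw [hupd c hc]
        exact hgZ c hc

/-- Lifting an embedding of the tree into the base graph, all of whose edges carry the colour `c₀`,
to an induced monochromatic copy of the blowup `H` in the host graph. Left vertices of `H` go to the
chosen elements `S`; flexibility then provides the places of the right vertices. -/
theorem exists_embedding_of_flexible {V W : Type*} {T : SimpleGraph V} {H : SimpleGraph W}
    (hw : 0 < w) (hH : IsBlowup w H T) (hT : ∀ v, ∃ u, T.Adj v u) (f : Fin N × Fin d → Fin N)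
    (χ : (hostGraph f r).EdgeLabeling (Fin q))
    (col : Fin N → Fin N → Finset (Fin r) → Finset (Fin r) → Fin q)
    (hcol : ∀ x y i j (h : (hostGraph f r).Adj (Sum.inl x, i) (Sum.inr y, j)),
      χ.get _ _ h = col y x i j)
    (c : Fin N → Fin N → Fin q) (c₀ : Fin q) (S : Fin N × Fin w → Finset (Fin r))
    (Q : Finset (Fin N × Fin d))
    (hQ : ∀ p ∈ Q, c (f p) p.1 = c₀ ∧
      Flexible ({x | ∃ l, f (x, l) = f p} : Finset (Fin N)) (col (f p)) (c (f p)) S)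
    (ψ : V → Fin N ⊕ Fin N) (hψ : Function.Injective ψ)
    (hadj : ∀ u v, T.Adj u v → ∃ p ∈ Q, (ψ u = Sum.inl p.1 ∧ ψ v = Sum.inr (f p)) ∨
      (ψ v = Sum.inl p.1 ∧ ψ u = Sum.inr (f p))) :
    ∃ (F : H ↪g hostGraph f r) (c : Fin q), ∀ (u v : W) (h : H.Adj u v),
      χ.get (F u) (F v) (F.map_adj_iff.mpr h) = c := by
  classical
  obtain ⟨φ, hφ⟩ := hH
  let nbr : Fin N → Finset (Fin N) := fun y => {x | ∃ l, f (x, l) = y}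
  have hpair : ∀ u v x y, T.Adj u v → ψ u = Sum.inl x → ψ v = Sum.inr y →
      ∃ p ∈ Q, p.1 = x ∧ f p = y := by
    intro u v x y huv hu hv
    obtain ⟨p, hp, ⟨h1, h2⟩ | ⟨h1, h2⟩⟩ := hadj u v huv
    · rw [hu, Sum.inl.injEq] at h1
      rw [hv, Sum.inr.injEq] at h2
      exact ⟨p, hp, h1.symm, h2.symm⟩
    · rw [hv] at h1
      exact absurd h1 (by simp)
  have hflex : ∀ v y, ψ v = Sum.inr y → Flexible (nbr y) (col y) (c y) S := by
    intro v y hv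
    obtain ⟨u, hu⟩ := hT v
    obtain ⟨p, hp, ⟨h1, h2⟩ | ⟨h1, h2⟩⟩ := hadj v u hu
    · rw [hv] at h1
      exact absurd h1 (by simp)
    · rw [hv, Sum.inr.injEq] at h2
      rw [h2]
      exact (hQ p hp).2
  have hidx : ∃ idx : W → Fin w, ∀ a b, φ a = φ b → idx a = idx b → a = b := by
    have hemb : ∀ v, Nonempty ((φ ⁻¹' {v}) ↪ Fin w) := by
      intro v
      have hfin : (φ ⁻¹' {v}).Finite := Set.finite_of_encard_le_coe (hφ v)
      have := hfin.fintype
      refine Function.Embedding.nonempty_of_card_le ?_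
      have h1 := hφ v
      rw [← Set.coe_fintypeCard] at h1
      rw [Fintype.card_fin]
      exact_mod_cast h1
    let emb : ∀ v, (φ ⁻¹' {v}) ↪ Fin w := fun v => (hemb v).some
    refine ⟨fun a => emb (φ a) ⟨a, rfl⟩, fun a b hab h => ?_⟩
    have key : ∀ v (hv : φ b = v), emb (φ b) ⟨b, rfl⟩ = emb v ⟨b, hv⟩ := by
      rintro v rfl
      rfl
    exact congrArg Subtype.val ((emb (φ a)).injective (h.trans (key (φ a) hab.symm)))
  obtain ⟨idx, hidx⟩ := hidx
  let σ : W → Fin N → Finset (Fin N × Fin w) := fun h y =>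
    {e ∈ nbr y ×ˢ univ | ∃ h', H.Adj h h' ∧ ψ (φ h') = Sum.inl e.1 ∧ idx h' = e.2}
  let Z : W → Fin N → Finset (Finset (Fin r)) := fun h y =>
    {j | (∀ e ∈ σ h y, Hadamard (S e) j ∧ col y e.1 (S e) j = c y e.1) ∧
      ∀ e ∈ (nbr y ×ˢ univ) \ σ h y, ¬ Hadamard (S e) j}
  have hg : ∀ v, ∃ g : W → Finset (Fin r), Set.InjOn g (φ ⁻¹' {v}) ∧
      (∀ h x, ψ v = Sum.inl x → g h = S (x, idx h)) ∧
      ∀ h y, φ h = v → ψ v = Sum.inr y → g h ∈ Z h y := by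
    intro v
    rcases hv : ψ v with x | y
    · refine ⟨fun h => S (x, idx h), ?_, by simp, by simp⟩
      -- distinct elements of `S` over one left vertex, since some blob separates them
      intro a ha b hb hab
      dsimp only at hab
      obtain ⟨u, hu⟩ := hT v
      obtain ⟨p, hp, ⟨h1, h2⟩ | ⟨h1, h2⟩⟩ := hadj v u hu
      · rw [hv, Sum.inl.injEq] at h1
        by_contra hne
        have hmem : ∀ l : Fin w, (x, l) ∈ ({x | ∃ l, f (x, l) = f p} : Finset (Fin N)) ×ˢ
            (univ : Finset (Fin w)) := fun l =>
          mem_product.mpr ⟨mem_filter.mpr ⟨mem_univ _, p.2, by rw [h1]⟩, mem_univ _⟩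
        have hcard := (hQ p hp).2 {(x, idx a)} (singleton_subset_iff.mpr (hmem _))
        obtain ⟨j, hj⟩ := card_pos.mp (hw.trans_le hcard)
        obtain ⟨-, h3, h4⟩ := mem_filter.mp hj
        have h5 := (h3 _ (mem_singleton_self _)).1
        refine h4 (x, idx b) (mem_sdiff.mpr ⟨hmem _, fun h => hne ?_⟩) (hab ▸ h5)
        have h6 : idx b = idx a := congrArg Prod.snd (mem_singleton.mp h)
        exact hidx a b (ha.trans hb.symm) h6.symm
      · rw [hv] at h2
        exact absurd h2 (by simp)
    · have hfin : (φ ⁻¹' {v}).Finite := Set.finite_of_encard_le_coe (hφ v)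
      obtain ⟨g, hg, hgZ⟩ := exists_injOn_mem hfin.toFinset (fun h => Z h y) ∅ (fun h hh => by
        have h1 : #hfin.toFinset ≤ w := by
          have := hφ v
          rw [hfin.encard_eq_coe_toFinset_card] at this
          exact_mod_cast this
        exact h1.trans (hflex v y hv (σ h y) (filter_subset _ _)))
      refine ⟨g, by simpa using hg, by simp, fun h y' hh hy' => ?_⟩
      rw [Sum.inr.injEq] at hy'
      subst hy'
      exact hgZ h (by simpa using hh)
  choose g hginj hgl hgZ using hg
  let F : W → (Fin N ⊕ Fin N) × Finset (Fin r) := fun h => (ψ (φ h), g (φ h) h)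
  have hFl : ∀ h x, ψ (φ h) = Sum.inl x → F h = (Sum.inl x, S (x, idx h)) := by
    intro h x hx
    rw [← hgl (φ h) h x hx, ← hx]
  have hFr : ∀ h y, ψ (φ h) = Sum.inr y → F h = (Sum.inr y, g (φ h) h) := by
    intro h y hy
    rw [← hy]
  have hiff : ∀ h h' x y, ψ (φ h') = Sum.inl x → ψ (φ h) = Sum.inr y →
      ((hostGraph f r).Adj (F h') (F h) ↔ H.Adj h' h) := by
    intro h h' x y hx hy
    rw [hFl h' x hx, hFr h y hy]
    have hz := (mem_filter.mp (hgZ (φ h) h y rfl hy)).2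
    constructor
    · rintro ⟨hl, hH⟩
      have hmem : (x, idx h') ∈ nbr y ×ˢ (univ : Finset (Fin w)) :=
        mem_product.mpr ⟨mem_filter.mpr ⟨mem_univ _, hl⟩, mem_univ _⟩
      by_cases hσ : (x, idx h') ∈ σ h y
      · obtain ⟨h'', hadj'', hx'', hi''⟩ := (mem_filter.mp hσ).2
        have : h'' = h' := hidx _ _ (hψ (hx''.trans hx.symm)) hi''
        exact (this ▸ hadj'').symm
      · exact (hz.2 _ (mem_sdiff.mpr ⟨hmem, hσ⟩) hH).elim
    · intro hadj'
      obtain ⟨p, -, h1, h2⟩ := hpair _ _ x y (φ.map_adj hadj') hx hy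
      have hl : ∃ l, f (x, l) = y := ⟨p.2, by rw [← h1, ← h2]⟩
      exact ⟨hl, (hz.1 (x, idx h') (mem_filter.mpr ⟨mem_product.mpr
        ⟨mem_filter.mpr ⟨mem_univ _, hl⟩, mem_univ _⟩, h', hadj'.symm, hx, rfl⟩)).1⟩
  have hFinj : Function.Injective F := by
    intro a b hab
    have hφab : φ a = φ b := hψ (congrArg Prod.fst hab)
    have h2 : g (φ a) a = g (φ b) b := congrArg Prod.snd hab
    rw [hφab] at h2
    exact hginj (φ b) hφab rfl h2
  have hFadj : ∀ a b, (hostGraph f r).Adj (F a) (F b) ↔ H.Adj a b := by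
    intro a b
    rcases ha : ψ (φ a) with x | x <;> rcases hb : ψ (φ b) with y | y
    · refine iff_of_false ?_ fun h => ?_
      · rw [hFl a x ha, hFl b y hb]
        exact id
      · obtain ⟨p, hp, ⟨h1, h2⟩ | ⟨h1, h2⟩⟩ := hadj _ _ (φ.map_adj h)
        · exact absurd (hb.symm.trans h2) (by simp)
        · exact absurd (ha.symm.trans h2) (by simp)
    · exact hiff b a x y ha hb
    · rw [(hostGraph f r).adj_comm, H.adj_comm]
      exact hiff a b y x hb ha
    · refine iff_of_false ?_ fun h => ?_
      · rw [hFr a x ha, hFr b y hb]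
        exact id
      · obtain ⟨p, hp, ⟨h1, h2⟩ | ⟨h1, h2⟩⟩ := hadj _ _ (φ.map_adj h)
        · exact absurd (ha.symm.trans h1) (by simp)
        · exact absurd (hb.symm.trans h1) (by simp)
  have hFcol : ∀ a b x y, ψ (φ a) = Sum.inl x → ψ (φ b) = Sum.inr y → H.Adj a b →
      ∀ h : (hostGraph f r).Adj (F a) (F b), χ.get (F a) (F b) h = c₀ := by
    intro a b x y ha hb hab
    rw [hFl a x ha, hFr b y hb]
    intro h
    obtain ⟨p, hp, h1, h2⟩ := hpair _ _ x y (φ.map_adj hab) ha hb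
    have hl : ∃ l, f (x, l) = y := ⟨p.2, by rw [← h1, ← h2]⟩
    have hz := (mem_filter.mp (hgZ (φ b) b y rfl hb)).2
    have h3 := (hz.1 (x, idx a) (mem_filter.mpr ⟨mem_product.mpr
        ⟨mem_filter.mpr ⟨mem_univ _, hl⟩, mem_univ _⟩, a, hab.symm, ha, rfl⟩)).2
    rw [hcol, h3, ← (hQ p hp).1, h1, h2]
  refine ⟨⟨⟨F, hFinj⟩, hFadj _ _⟩, c₀, fun a b hab => ?_⟩
  obtain ⟨p, hp, ⟨h1, h2⟩ | ⟨h1, h2⟩⟩ := hadj _ _ (φ.map_adj hab)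
  · exact hFcol a b _ _ h1 h2 hab _
  · rw [SimpleGraph.EdgeLabeling.get_comm]
    exact hFcol b a _ _ h1 h2 hab.symm _

end Host

/-! ### The host graph arrows blowups -/

section Main

variable {N d r q w : ℕ}

/-- The host graph arrows `H` once the base graph is locally sparse and the blobs are large. -/
theorem hostGraph_arrows {V W : Type*} [Fintype V] {T : SimpleGraph V} [DecidableRel T.Adj]
    (hT : T.IsTree) (hV : 2 ≤ Fintype.card V) {H : SimpleGraph W} (hw : 0 < w)
    (hH : IsBlowup w H T) {k s t z : ℕ} (hq : 0 < q) (hd : d = 8 * q * s) (hs : 0 < s)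
    (hk : T.maxDegree ≤ k) (hN : (k + 1) * (2 * Fintype.card V) ≤ N) (f : Fin N × Fin d → Fin N)
    (hLR : ∀ X Y : Finset (Fin N), 1 ≤ #X → #X ≤ 2 * Fintype.card V → #Y = (k + 1) * #X →
      #{p ∈ X ×ˢ univ | f p ∈ Y} < s * #X)
    (hRL : ∀ X Y : Finset (Fin N), 1 ≤ #Y → #Y ≤ 2 * Fintype.card V → #X = (k + 1) * #Y →
      #{p ∈ X ×ˢ univ | f p ∈ Y} < s * #Y)
    (hheavy : ∀ Y : Finset (Fin N), 64 * #Y ≤ N → 2 * #{p | f p ∈ Y} < N * d)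
    (ht : t ≠ 0)
    (hbig : 2 * (2 ^ r) ^ (w * (64 * d)) * z ^ t *
      ((3 * q) ^ (64 * d) * (2 * q ^ (64 * d))) ^ t < (2 ^ r) ^ t)
    (hsize : (2 * (3 * q) ^ (64 * d * t)) ^ d * (18 * (64 * d)) ≤ 2 ^ r)
    (hflex : 9 * (2 ^ (64 * d * w) * (64 * d * w) * 256) * 3 ^ (64 * d * w) *
      (2 * (3 * q) ^ (64 * d * t)) ^ d ≤ z)
    (hz : 3 ^ (64 * d * w) * w ≤ z) :
    Arrows (hostGraph f r) H q := by
  classical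
  intro χ
  have : NeZero q := ⟨hq.ne'⟩
  have hdpos : 0 < d := by rw [hd]; positivity
  let col : Fin N → Fin N → Finset (Fin r) → Finset (Fin r) → Fin q := fun y x i j =>
    if h : (hostGraph f r).Adj (Sum.inl x, i) (Sum.inr y, j) then χ.get _ _ h else 0
  have hcol : ∀ x y i j (h : (hostGraph f r).Adj (Sum.inl x, i) (Sum.inr y, j)),
      χ.get _ _ h = col y x i j := fun x y i j h => (dif_pos h).symm
  let nbr : Fin N → Finset (Fin N) := fun y => {x | ∃ l, f (x, l) = y}
  -- right vertices of larger degree are never used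
  let Y : Finset (Fin N) := {y | #{p | f p = y} ≤ 64 * d}
  have hnbr : ∀ y ∈ Y, #(nbr y) ≤ 64 * d := by
    intro y hy
    refine (card_le_card (t := ({p | f p = y} : Finset (Fin N × Fin d)).image Prod.fst)
      fun x hx => ?_).trans (card_image_le.trans (mem_filter.mp hy).2)
    obtain ⟨l, hl⟩ := (mem_filter.mp hx).2
    exact mem_image.mpr ⟨(x, l), by simpa using hl, rfl⟩
  have hdeg : ∀ x, #{y ∈ Y | x ∈ nbr y} ≤ d := by
    intro x
    calc #{y ∈ Y | x ∈ nbr y} ≤ #((univ : Finset (Fin d)).image fun l => f (x, l)) := by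
          refine card_le_card fun y hy => ?_
          obtain ⟨l, hl⟩ := (mem_filter.mp (mem_filter.mp hy).2).2
          exact mem_image.mpr ⟨l, mem_univ _, hl⟩
      _ ≤ d := card_image_le.trans_eq (by simp)
  obtain ⟨c, A, hA, hrich⟩ := exists_rich ht (by omega : 0 < 64 * d) hbig hsize nbr col Y hnbr hdeg
  obtain ⟨S, Bad, hBadY, hBad, hS⟩ := exists_mostly_flexible (by omega : 0 < 64 * d) hw nbr col c A
    Y hnbr hrich (fun x => by
      calc 9 * 2 ^ r * (2 ^ (64 * d * w) * (64 * d * w) * 256) * 3 ^ (64 * d * w)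
          = 2 ^ r * (9 * (2 ^ (64 * d * w) * (64 * d * w) * 256) * 3 ^ (64 * d * w)) := by ring
        _ ≤ ((2 * (3 * q) ^ (64 * d * t)) ^ d * #(A x)) *
            (9 * (2 ^ (64 * d * w) * (64 * d * w) * 256) * 3 ^ (64 * d * w)) :=
          Nat.mul_le_mul_right _ (hA x)
        _ = #(A x) * (9 * (2 ^ (64 * d * w) * (64 * d * w) * 256) * 3 ^ (64 * d * w) *
            (2 * (3 * q) ^ (64 * d * t)) ^ d) := by ring
        _ ≤ #(A x) * z := Nat.mul_le_mul_left _ hflex) hz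
  -- at most half of the pairs end in a vertex outside `Y`, at most a quarter in `Bad`
  have hfib : ∀ B : Finset (Fin N), ∑ y ∈ B, #{p | f p = y} = #{p | f p ∈ B} := fun B =>
    sum_card_fiberwise_eq_card_filter univ B f
  have hall : #(univ : Finset (Fin N × Fin d)) = N * d := by simp
  have hYc : 2 * #{p | f p ∈ Yᶜ} < N * d := by
    refine hheavy _ ?_
    have h1 : #Yᶜ * (64 * d) ≤ ∑ y ∈ Yᶜ, #{p | f p = y} := by
      rw [← smul_eq_mul]
      refine card_nsmul_le_sum _ _ _ fun y hy => ?_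
      by_contra hlt
      exact mem_compl.mp hy (mem_filter.mpr ⟨mem_univ _, by omega⟩)
    have h2 := card_le_univ ({p | f p ∈ Yᶜ} : Finset (Fin N × Fin d))
    rw [hfib] at h1
    rw [← card_univ, hall] at h2
    refine Nat.le_of_mul_le_mul_right (c := d) ?_ hdpos
    calc 64 * #Yᶜ * d = #Yᶜ * (64 * d) := by ring
      _ ≤ N * d := h1.trans h2
  have hB : 4 * #{p | f p ∈ Bad} ≤ N * d := by
    have h1 : #{p | f p ∈ Bad} ≤ #Bad * (64 * d) := by
      rw [← hfib, ← smul_eq_mul]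
      exact sum_le_card_nsmul _ _ _ fun y hy => (mem_filter.mp (hBadY hy)).2
    have h2 : #Y ≤ N := (card_le_univ Y).trans_eq (Fintype.card_fin N)
    calc 4 * #{p | f p ∈ Bad} ≤ 4 * (#Bad * (64 * d)) := by gcongr
      _ = 256 * #Bad * d := by ring
      _ ≤ N * d := Nat.mul_le_mul_right _ (hBad.trans h2)
  let Gp : Finset (Fin N × Fin d) := {p | f p ∈ Y \ Bad}
  have hGp : N * d < 4 * #Gp := by
    have h1 : (univ : Finset (Fin N × Fin d)) ⊆
        ({p | f p ∈ Yᶜ} : Finset (Fin N × Fin d)) ∪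
          ({p | f p ∈ Bad} : Finset (Fin N × Fin d)) ∪ Gp := by
      intro p _
      simp only [Gp, mem_union, mem_filter, mem_univ, true_and, mem_compl, mem_sdiff]
      tauto
    have h2 := (card_le_card h1).trans ((card_union_le _ _).trans
      (Nat.add_le_add_right (card_union_le _ _) _))
    rw [hall] at h2
    omega
  obtain ⟨c₀, -, hc₀⟩ := exists_max_image (univ : Finset (Fin q))
    (fun c₀ => #{p ∈ Gp | c (f p) p.1 = c₀}) ⟨0, mem_univ _⟩
  set Q : Finset (Fin N × Fin d) := {p ∈ Gp | c (f p) p.1 = c₀} with hQ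
  have hQcard : s * (2 * N) < #Q := by
    have h1 : #Gp ≤ q * #Q := by
      rw [card_eq_sum_card_fiberwise (f := fun p => c (f p) p.1) (t := univ) fun _ _ => mem_univ _]
      refine (sum_le_card_nsmul _ _ _ hc₀).trans_eq ?_
      rw [card_univ, Fintype.card_fin, smul_eq_mul]
    refine Nat.lt_of_mul_lt_mul_left (a := 4 * q) ?_
    calc 4 * q * (s * (2 * N)) = N * d := by rw [hd]; ring
      _ < 4 * #Gp := hGp
      _ ≤ 4 * (q * #Q) := by gcongr
      _ = 4 * q * #Q := by ring
  obtain ⟨ψ, hψ, hadj⟩ := exists_tree_in_dense_part hT hk hN f hLR hRL Q hQcard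
  have : Nontrivial V := Fintype.one_lt_card_iff_nontrivial.mp hV
  refine exists_embedding_of_flexible hw hH (fun v => ?_) f χ col hcol c c₀ S Q (fun p hp => ?_) ψ
    hψ hadj
  · exact (T.degree_pos_iff_exists_adj v).mp (hT.connected.preconnected.degree_pos_of_nontrivial v)
  · obtain ⟨h1, h2⟩ := mem_filter.mp hp
    obtain ⟨h3, h4⟩ := mem_sdiff.mp (mem_filter.mp h1).2
    exact ⟨h2, hS (f p) h3 h4⟩

theorem three_mul_le_two_pow (q : ℕ) : 3 * q ≤ 2 ^ (2 * q) := by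
  induction q with
  | zero => simp
  | succ q ih =>
    have h1 : 2 ^ (2 * (q + 1)) = 4 * 2 ^ (2 * q) := by rw [mul_add, pow_add]; ring
    have h2 : 1 ≤ 2 ^ (2 * q) := Nat.one_le_two_pow
    omega

/-- The blobs of size `2 ^ (2 * ρ)` with `ρ = 25 * q * w * D ^ 3` are large enough, when the base
graph has maximum degree at most `D`. -/
theorem blob_size_conditions {D : ℕ} (hq : 1 ≤ q) (hw : 1 ≤ w) (hd : 1 ≤ d) (hD : D = 64 * d) :
    let ρ := 25 * q * w * D ^ 3
    let t := 4 * w * D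
    2 * (2 ^ (2 * ρ)) ^ (w * D) * (2 ^ ρ) ^ t * ((3 * q) ^ D * (2 * q ^ D)) ^ t <
        (2 ^ (2 * ρ)) ^ t ∧
      (2 * (3 * q) ^ (D * t)) ^ d * (18 * D) ≤ 2 ^ (2 * ρ) ∧
      9 * (2 ^ (D * w) * (D * w) * 256) * 3 ^ (D * w) * (2 * (3 * q) ^ (D * t)) ^ d ≤ 2 ^ ρ ∧
      3 ^ (D * w) * w ≤ 2 ^ ρ := by
  intro ρ t
  have hDpos : 1 ≤ D := by omega
  have h3q := three_mul_le_two_pow q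
  have hq2 : q ≤ 2 ^ q := Nat.lt_two_pow_self.le
  have hx : 1 ≤ w * D := Nat.mul_pos hw hDpos
  have hD3 : D ≤ D ^ 3 := Nat.le_self_pow (by norm_num) D
  -- every part of the exponents is bounded by a multiple of `m = q * w * D ^ 3`
  set m := q * w * D ^ 3 with hm
  have hρ : ρ = 25 * m := by simp only [ρ, hm]; ring
  have hqD : q * D ≤ m := by
    calc q * D = q * 1 * D := by ring
      _ ≤ m := by rw [hm]; gcongr
  have hDw : D * w ≤ m := by
    calc D * w = 1 * w * D := by ring
      _ ≤ m := by rw [hm]; gcongr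
  have hm1 : 1 ≤ m := (Nat.mul_pos hDpos hw).trans_le hDw
  have hdD : d ≤ D := by omega
  have hdm : d ≤ m := hdD.trans ((Nat.le_mul_of_pos_right D hw).trans hDw)
  have hΘ : (2 * (3 * q) ^ (D * t)) ^ d ≤ 2 ^ (9 * m) := by
    calc (2 * (3 * q) ^ (D * t)) ^ d ≤ (2 * (2 ^ (2 * q)) ^ (D * t)) ^ d := by gcongr
      _ = 2 ^ (d + 8 * (q * w * (D * D * d))) := by
        rw [← pow_mul, ← pow_succ', ← pow_mul]
        congr 1
        simp only [t]
        ring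
      _ ≤ 2 ^ (9 * m) := by
        refine Nat.pow_le_pow_right (by norm_num) ?_
        have h1 : q * w * (D * D * d) ≤ m := by
          calc q * w * (D * D * d) ≤ q * w * (D * D * D) := by gcongr
            _ = m := by rw [hm]; ring
        omega
  have h3 : 3 ^ (D * w) ≤ 2 ^ (2 * m) := by
    calc 3 ^ (D * w) ≤ (2 ^ 2) ^ (D * w) := by gcongr; norm_num
      _ = 2 ^ (2 * (D * w)) := by rw [← pow_mul]
      _ ≤ 2 ^ (2 * m) := by gcongr; norm_num
  have h2 : 2 ^ (D * w) ≤ 2 ^ m := by gcongr; norm_num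
  have hDw2 : D * w ≤ 2 ^ m := hDw.trans Nat.lt_two_pow_self.le
  have h9 : 9 * 256 ≤ 2 ^ (12 * m) := by
    calc 9 * 256 ≤ 2 ^ (12 * 1) := by norm_num
      _ ≤ 2 ^ (12 * m) := by gcongr; norm_num
  refine ⟨?_, ?_, ?_, ?_⟩
  · have hu : (3 * q) ^ D * (2 * q ^ D) ≤ 2 ^ (3 * (q * D) + 1) := by
      calc (3 * q) ^ D * (2 * q ^ D) ≤ (2 ^ (2 * q)) ^ D * (2 * (2 ^ q) ^ D) := by gcongr
        _ = 2 ^ (3 * (q * D) + 1) := by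
          rw [← pow_mul, ← pow_mul, ← pow_succ', ← pow_add]
          congr 1
          ring
    calc 2 * (2 ^ (2 * ρ)) ^ (w * D) * (2 ^ ρ) ^ t * ((3 * q) ^ D * (2 * q ^ D)) ^ t
        ≤ 2 * (2 ^ (2 * ρ)) ^ (w * D) * (2 ^ ρ) ^ t * (2 ^ (3 * (q * D) + 1)) ^ t := by gcongr
      _ = 2 ^ (1 + 6 * ρ * (w * D) + (3 * (q * D) + 1) * (4 * (w * D))) := by
        rw [← pow_mul, ← pow_mul, ← pow_mul, ← pow_succ', ← pow_add, ← pow_add]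
        congr 1
        simp only [t]
        ring
      _ < 2 ^ (8 * ρ * (w * D)) := by
        refine Nat.pow_lt_pow_right (by norm_num) ?_
        have h1 : (3 * (q * D) + 1) * 4 + 2 ≤ 2 * ρ := by omega
        nlinarith
      _ = (2 ^ (2 * ρ)) ^ t := by
        rw [← pow_mul]
        congr 1
        simp only [t]
        ring
  · have h18 : 18 * D ≤ 2 ^ (6 * m) := by
      have h1 : D ≤ 2 ^ m := (Nat.le_mul_of_pos_right D hw).trans hDw2
      calc 18 * D ≤ 2 ^ (5 * 1) * 2 ^ m := Nat.mul_le_mul (by norm_num) h1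
        _ ≤ 2 ^ (5 * m) * 2 ^ m := by gcongr; norm_num
        _ = 2 ^ (6 * m) := by rw [← pow_add]; congr 1; ring
    calc (2 * (3 * q) ^ (D * t)) ^ d * (18 * D) ≤ 2 ^ (9 * m) * 2 ^ (6 * m) :=
          Nat.mul_le_mul hΘ h18
      _ = 2 ^ (15 * m) := by rw [← pow_add]; congr 1; ring
      _ ≤ 2 ^ (2 * ρ) := Nat.pow_le_pow_right (by norm_num) (by omega)
  · calc 9 * (2 ^ (D * w) * (D * w) * 256) * 3 ^ (D * w) * (2 * (3 * q) ^ (D * t)) ^ d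
        = (9 * 256) * (2 ^ (D * w) * (D * w)) * 3 ^ (D * w) * (2 * (3 * q) ^ (D * t)) ^ d := by
          ring
      _ ≤ 2 ^ (12 * m) * (2 ^ m * 2 ^ m) * 2 ^ (2 * m) * 2 ^ (9 * m) := by gcongr
      _ = 2 ^ ρ := by
        rw [← pow_add, ← pow_add, ← pow_add, ← pow_add, hρ]
        congr 1
        ring
  · calc 3 ^ (D * w) * w ≤ 2 ^ (2 * m) * 2 ^ m :=
          Nat.mul_le_mul h3 ((Nat.le_mul_of_pos_left w hDpos).trans hDw2)
      _ = 2 ^ (3 * m) := by rw [← pow_add]; congr 1; ring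
      _ ≤ 2 ^ ρ := Nat.pow_le_pow_right (by norm_num) (by omega)

/-- The constant in the exponent of the bounds. The number of vertices and the degrees of the base
graph account for `26`, the four factors `2 ^ ρ` of the number of edges of a blown-up edge for the
rest, where `D ≤ 3072 * q * k`. -/
def ramseyConst : ℕ := 26 + 100 * 3072 ^ 3

theorem sizeRamsey_blowup_le {V W : Type*} [Fintype V] {T : SimpleGraph V} [DecidableRel T.Adj]
    (hT : T.IsTree) (hV : 2 ≤ Fintype.card V) {H : SimpleGraph W} (hw : 0 < w)
    (hH : IsBlowup w H T) {k : ℕ} (hq : 1 ≤ q) (hk1 : 1 ≤ k) (hkq : 2 ≤ k * q)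
    (hk : T.maxDegree ≤ k) :
    sizeRamsey H q ≤
      (((k * q) ^ (ramseyConst * q ^ 4 * k ^ 3 * w) * Fintype.card V : ℕ) : ℕ∞) := by
  set n := Fintype.card V with hn
  obtain ⟨N, hN⟩ : ∃ N, N = 27648 * q ^ 2 * (k + 1) ^ 2 * n := ⟨_, rfl⟩
  obtain ⟨d, hd⟩ : ∃ d, d = 16 * q * (k + 1 + 1) := ⟨_, rfl⟩
  obtain ⟨f, hLR, hRL, hheavy⟩ := exists_locally_sparse hN hd (by omega) hq (by omega)
  set D := 64 * d with hD
  have hdpos : 1 ≤ d := by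
    have : 0 < d := by rw [hd]; positivity
    omega
  obtain ⟨h1, h2, h3, h4⟩ := blob_size_conditions (q := q) (w := w) (d := d) hq hw hdpos hD
  set ρ := 25 * q * w * D ^ 3 with hρ
  have harrow : Arrows (hostGraph f (2 * ρ)) H q := by
    refine hostGraph_arrows hT hV hw hH (s := 2 * (k + 1 + 1)) hq (by rw [hd]; ring) (by omega) hk
      ?_ f hLR hRL hheavy ?_ h1 h2 h3 h4
    · rw [hN]
      calc (k + 1) * (2 * n) = 2 * 1 * ((k + 1) * 1) * n := by ring
        _ ≤ 27648 * q ^ 2 * ((k + 1) * (k + 1)) * n := by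
          gcongr
          · norm_num
          · exact Nat.one_le_pow _ _ hq
          · omega
        _ = 27648 * q ^ 2 * (k + 1) ^ 2 * n := by ring
    · positivity
  refine (sizeRamsey_le_encard harrow).trans ((encard_edgeSet_hostGraph_le f _).trans ?_)
  have hexp : 1 ≤ q ^ 4 * k ^ 3 * w := by
    have : 0 < q ^ 4 * k ^ 3 * w := by positivity
    omega
  have hNd : N * d ≤ (k * q) ^ 26 * n := by
    calc N * d ≤ (27648 * q ^ 2 * (2 * k) ^ 2 * n) * (16 * q * (3 * k)) := by
          rw [hN, hd]
          gcongr <;> omega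
      _ = 5308416 * (k * q) ^ 3 * n := by ring
      _ ≤ 2 ^ 23 * (k * q) ^ 3 * n := by gcongr; norm_num
      _ ≤ (k * q) ^ 23 * (k * q) ^ 3 * n := by gcongr
      _ = (k * q) ^ 26 * n := by rw [← pow_add]
  have hρle : 4 * ρ ≤ 100 * 3072 ^ 3 * (q ^ 4 * k ^ 3 * w) := by
    have hDle : D ≤ 3072 * (q * k) := by
      calc D = 1024 * q * (k + 1 + 1) := by rw [hD, hd]; ring
        _ ≤ 1024 * q * (3 * k) := by gcongr; omega
        _ = 3072 * (q * k) := by ring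
    calc 4 * ρ = 100 * (q * w * D ^ 3) := by rw [hρ]; ring
      _ ≤ 100 * (q * w * (3072 * (q * k)) ^ 3) := by gcongr
      _ = 100 * 3072 ^ 3 * (q ^ 4 * k ^ 3 * w) := by ring
  have hfinal : N * d * (2 ^ (2 * ρ) * 2 ^ (2 * ρ)) ≤
      (k * q) ^ (ramseyConst * q ^ 4 * k ^ 3 * w) * n := by
    calc N * d * (2 ^ (2 * ρ) * 2 ^ (2 * ρ)) = N * d * 2 ^ (4 * ρ) := by
          rw [← pow_add]; congr 2; ring
      _ ≤ (k * q) ^ 26 * n * (k * q) ^ (100 * 3072 ^ 3 * (q ^ 4 * k ^ 3 * w)) := by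
          refine Nat.mul_le_mul hNd ?_
          exact (Nat.pow_le_pow_left hkq _).trans (Nat.pow_le_pow_right (by omega) hρle)
      _ = (k * q) ^ (26 + 100 * 3072 ^ 3 * (q ^ 4 * k ^ 3 * w)) * n := by
          rw [pow_add]; ring
      _ ≤ (k * q) ^ (ramseyConst * q ^ 4 * k ^ 3 * w) * n := by
          refine Nat.mul_le_mul_right _ (Nat.pow_le_pow_right (by omega) ?_)
          have : ramseyConst * q ^ 4 * k ^ 3 * w =
              26 * (q ^ 4 * k ^ 3 * w) + 100 * 3072 ^ 3 * (q ^ 4 * k ^ 3 * w) := by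
            rw [ramseyConst]; ring
          omega
  exact_mod_cast hfinal

end Main

/-! ### Small cases and the final bounds -/

section SmallCases

theorem arrows_self {W : Type*} (H : SimpleGraph W) {q : ℕ} (c : Fin q)
    (h : ∀ (χ : H.EdgeLabeling (Fin q)) u v (huv : H.Adj u v), χ.get u v huv = c) :
    Arrows H H q :=
  fun χ => ⟨SimpleGraph.Embedding.refl, c, fun u v huv => h χ u v huv⟩

theorem sizeRamsey_eq_zero {W : Type*} [Finite W] {H : SimpleGraph W} (hH : ∀ u v, ¬ H.Adj u v)
    {q : ℕ} (hq : 1 ≤ q) : sizeRamsey H q = 0 := by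
  have := Fintype.ofFinite W
  have h1 := sizeRamsey_le_encard (arrows_self H (⟨0, hq⟩ : Fin q)
    fun _ u v huv => (hH u v huv).elim)
  obtain rfl : H = ⊥ := by
    ext u v
    simpa using hH u v
  simpa using h1

theorem isBlowup_one_self {V : Type*} (T : SimpleGraph V) : IsBlowup 1 T T :=
  ⟨SimpleGraph.Hom.id, fun v => by simp⟩

theorem sizeRamsey_le_of_isBlowup {V W : Type*} [Fintype V] {T : SimpleGraph V}
    [DecidableRel T.Adj] (hT : T.IsTree) (hV : 2 ≤ Fintype.card V) {H : SimpleGraph W} {w : ℕ}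
    (hH : IsBlowup w H T) {k q : ℕ} (hq : 1 ≤ q) (hk1 : 1 ≤ k) (hkq : 2 ≤ k * q)
    (hk : T.maxDegree ≤ k) :
    sizeRamsey H q ≤
      (((k * q) ^ (ramseyConst * q ^ 4 * k ^ 3 * w) * Fintype.card V : ℕ) : ℕ∞) := by
  rcases Nat.eq_zero_or_pos w with rfl | hw
  · obtain ⟨φ, hφ⟩ := hH
    have : IsEmpty W := ⟨fun a => by
      have h3 := hφ (φ a)
      rw [Nat.cast_zero, nonpos_iff_eq_zero, Set.encard_eq_zero] at h3
      exact Set.notMem_empty a (h3 ▸ rfl)⟩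
    rw [sizeRamsey_eq_zero (fun u => isEmptyElim u) hq]
    exact zero_le
  · exact sizeRamsey_blowup_le hT hV hw hH hq hk1 hkq hk

end SmallCases

end IndRamsey

theorem theorem1p3 :
    ∃ C : ℕ, ∀ (V : Type*) [Fintype V] (T : SimpleGraph V) [DecidableRel T.Adj] (n k q : ℕ),
      T.IsTree → Fintype.card V = n → T.maxDegree = k → 1 ≤ q →
        IndRamsey.ramsey T q ≤ (((k * q) ^ (C * q ^ 4 * k ^ 3) * n : ℕ) : ℕ∞) ∧
        IndRamsey.sizeRamsey T q ≤ (((k * q) ^ (C * q ^ 4 * k ^ 3) * n : ℕ) : ℕ∞) ∧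
        IndRamsey.ramsey T q ≤ IndRamsey.sizeRamsey T q + 1 ∧
        (2 ≤ q → k + 2 ≤ n → IndRamsey.ramsey T q ≤ IndRamsey.sizeRamsey T q) ∧
        (k * q ≠ 1 → ∀ (W : Type*) (H : SimpleGraph W) (w : ℕ), IndRamsey.IsBlowup w H T →
          IndRamsey.sizeRamsey H q ≤ (((k * q) ^ (C * q ^ 4 * k ^ 3 * w) * n : ℕ) : ℕ∞)) := by
  open IndRamsey in
  refine ⟨ramseyConst + 1, fun V _ T _ n k q hT hn hk hq => ?_⟩
  have hpart3 := ramsey_le_sizeRamsey_add_one hT.connected q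
  have hpart4 : 2 ≤ q → k + 2 ≤ n → ramsey T q ≤ sizeRamsey T q := fun hq2 hkn =>
    ramsey_le_sizeRamsey hT.connected hq2 (exists_not_adj_of_maxDegree T (by omega))
  have hnpos : 1 ≤ n := by
    have := hT.connected.nonempty
    rw [← hn]
    exact Fintype.card_pos
  rcases hnpos.eq_or_lt with h1 | h2
  · have hsub : Subsingleton V := Fintype.card_le_one_iff_subsingleton.mp (by omega)
    have hno : ∀ u v, ¬ T.Adj u v := fun u v h => h.ne (Subsingleton.elim u v)
    obtain rfl : k = 0 := by
      rw [← hk, ← Nat.le_zero]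
      refine T.maxDegree_le_of_forall_degree_le 0 fun v => ?_
      rw [Nat.le_zero, ← T.card_neighborFinset_eq_degree, Finset.card_eq_zero]
      ext u
      simp
    refine ⟨?_, ?_, hpart3, hpart4, fun _ W H w ⟨φ, hφ⟩ => ?_⟩
    · refine (ramsey_le_card (arrows_self T (⟨0, hq⟩ : Fin q)
        fun _ u v huv => (hno u v huv).elim)).trans ?_
      simp [hn]
    · rw [sizeRamsey_eq_zero hno hq]
      exact zero_le
    · obtain ⟨v⟩ := hT.connected.nonempty
      have : Finite W := by
        rw [← Set.finite_univ_iff]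
        refine (Set.finite_of_encard_le_coe (hφ v)).subset fun h _ => ?_
        exact Subsingleton.elim _ _
      rw [sizeRamsey_eq_zero (fun u v h => hno _ _ (φ.map_adj h)) hq]
      exact zero_le
  · have hnt : Nontrivial V := Fintype.one_lt_card_iff_nontrivial.mp (by omega)
    have hk1 : 1 ≤ k := by
      obtain ⟨v⟩ := hT.connected.nonempty
      have h3 := hT.connected.preconnected.degree_pos_of_nontrivial v
      have h4 := T.degree_le_maxDegree v
      omega
    rcases eq_or_ne (k * q) 1 with hkq | hkq
    · obtain rfl : q = 1 := Nat.eq_one_of_mul_eq_one_left hkq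
      have harrow : Arrows T T 1 := arrows_self T 0 fun _ _ _ _ => Subsingleton.elim _ _
      have hsize : sizeRamsey T 1 ≤ (n : ℕ∞) := by
        classical
        refine (sizeRamsey_le_encard harrow).trans ?_
        have h3 := hT.card_edgeFinset
        rw [← SimpleGraph.coe_edgeFinset, Set.encard_coe_eq_coe_finsetCard]
        exact_mod_cast (by omega : T.edgeFinset.card ≤ n)
      refine ⟨?_, ?_, hpart3, hpart4, fun hne => (hne hkq).elim⟩
      · rw [hkq, one_pow, one_mul, ← hn]
        exact ramsey_le_card harrow
      · rwa [hkq, one_pow, one_mul]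
    · have hkq2 : 2 ≤ k * q := by
        have : 0 < k * q := Nat.mul_pos hk1 hq
        omega
      have hmono : ∀ e, (k * q) ^ (ramseyConst * q ^ 4 * k ^ 3 * e) * n ≤
          (k * q) ^ ((ramseyConst + 1) * q ^ 4 * k ^ 3 * e) * n := by
        intro e
        gcongr <;> omega
      have hsize := sizeRamsey_le_of_isBlowup hT (by omega) (isBlowup_one_self T) hq hk1 hkq2 hk.le
      rw [hn, mul_one] at hsize
      refine ⟨?_, hsize.trans ?_, hpart3, hpart4, fun _ W H w hH => ?_⟩
      · refine (hpart3.trans (add_le_add_left hsize 1)).trans ?_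
        -- the larger constant in the exponent absorbs the additional vertex
        have h3 : (k * q) ^ (ramseyConst * q ^ 4 * k ^ 3) * n + 1 ≤
            (k * q) ^ ((ramseyConst + 1) * q ^ 4 * k ^ 3) * n := by
          set b := (k * q) ^ (ramseyConst * q ^ 4 * k ^ 3) * n with hb
          have hb1 : 1 ≤ b := by
            have : 0 < b := by positivity
            omega
          calc b + 1 ≤ 2 * b := by omega
            _ ≤ (k * q) ^ (q ^ 4 * k ^ 3) * b := by
              refine Nat.mul_le_mul_right _ (hkq2.trans (Nat.le_self_pow ?_ _))
              positivity
            _ = (k * q) ^ ((ramseyConst + 1) * q ^ 4 * k ^ 3) * n := by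
              rw [hb, ← mul_assoc, ← pow_add]
              congr 2
              ring
        exact_mod_cast h3
      · have h3 := hmono 1
        rw [mul_one, mul_one] at h3
        exact_mod_cast h3
      · have h3 := sizeRamsey_le_of_isBlowup hT (by omega) hH hq hk1 hkq2 hk.le
        rw [hn] at h3
        exact h3.trans (by exact_mod_cast hmono w)
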